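/- Let $K\subseteq L$ be number fields such that $L/K$ is normal, and let $n=[L:K]$. Let $\mathcal A$ be the set of nonzero prime ideals $\mathfrak p$ of $\mathcal O_K$ that split completely in $L$, that is, such that every prime $\mathfrak P$ of $\mathcal O_L$ above $\mathfrak p$ has ramification index and inertia degree $1$ over $\mathfrak p$. For a set $\mathcal S$ of nonzero primes of $\mathcal O_K$ put $$\zeta_{K,\mathcal S}(s)=\prod_{\mathfrak p\in\mathcal S}\bigl(1-N(\mathfrak p)^{-s}\bigr)^{-1},\qquad \operatorname{Re}(s)>1,\qquad N(\mathfrak p)=|\mathcal O_K/\mathfrak p|.$$ Say that $\mathcal S$ has polar density $m/k$, for integers $k\ge 1$ and $m\ge 0$, if $\zeta_{K,\mathcal S}^{\,k}$ extends to a meromorphic function in a neighbourhood of $s=1$ having a pole of order $m$ at $s=1$ (for $m=0$: holomorphic and nonzero at $s=1$). Then $\mathcal A$ has polar density $1/n$. More precisely, $\zeta_{K,\mathcal A}^{\,n}$ extends to a meromorphic function in a neighbourhood of $s=1$ with a simple pole at $s=1$. -/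

import Mathlib

open NumberField IsDedekindDomain

namespace PolarDensity

/-- A nonzero prime `p` of `𝓞 K` splits completely in `L` if every prime `P` of `𝓞 L` lying over
`p` has ramification index `e(P | p) = 1` and inertia degree `f(P | p) = 1`. -/
def SplitsCompletely {K : Type*} (L : Type*) [Field K] [NumberField K] [Field L] [NumberField L]
    [Algebra K L] (p : HeightOneSpectrum (𝓞 K)) : Prop :=
  ∀ P : Ideal (𝓞 L), P.IsPrime → P.LiesOver p.asIdeal →
    P.ramificationIdx (𝓞 K) = 1 ∧ P.inertiaDeg (𝓞 K) = 1

/-- The set of nonzero primes of `𝓞 K` that split completely in `L`. -/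
def splitPrimes (K L : Type*) [Field K] [NumberField K] [Field L] [NumberField L]
    [Algebra K L] : Set (HeightOneSpectrum (𝓞 K)) :=
  {p | SplitsCompletely L p}

/-- The partial Dedekind zeta function `∏_{p ∈ A} (1 - N(p)^{-s})⁻¹` of a set `A` of nonzero primes
of `𝓞 K`; only its values in the half-plane `Re s > 1`, where the product converges absolutely,
are ever used. -/
noncomputable def partialZeta {K : Type*} [Field K] [NumberField K]
    (A : Set (HeightOneSpectrum (𝓞 K))) (s : ℂ) : ℂ :=
  ∏' p : A, (1 - (Ideal.absNorm p.1.asIdeal : ℂ) ^ (-s))⁻¹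

/-- The function `f`, regarded on the half-plane `Re s > 1`, extends to a meromorphic function in a
neighbourhood `U` of `s = 1` with a pole of order exactly `m` at `s = 1`
(`m = 0`: holomorphic and nonzero at `1` up to a removable singularity). -/
def ExtendsWithPoleAtOne (f : ℂ → ℂ) (m : ℕ) : Prop :=
  ∃ U : Set ℂ, IsOpen U ∧ (1 : ℂ) ∈ U ∧
    ∃ F : ℂ → ℂ, MeromorphicOn F U ∧ (∀ s ∈ U, 1 < s.re → F s = f s) ∧
      meromorphicOrderAt F 1 = ((-(m : ℤ) : ℤ) : WithTop ℤ)

/-- The set `A` has polar density `D` if `D = m / n` where, for some integer `n ≥ 1`, the `n`-th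
power of the partial zeta function of `A` extends meromorphically to a neighbourhood of `s = 1` with
a pole of order `m` there. -/
def HasPolarDensity {K : Type*} [Field K] [NumberField K]
    (A : Set (HeightOneSpectrum (𝓞 K))) (D : ℚ) : Prop :=
  ∃ n m : ℕ, 1 ≤ n ∧ ExtendsWithPoleAtOne (fun s ↦ partialZeta A s ^ n) m ∧
    D = (m : ℚ) / (n : ℚ)

end PolarDensity

/-! Put `n = [L:K]`. A completely split `p` has exactly `n` primes of `L` above it, all of norm
`N(p)`. Hence for `Re s > 1` the `n`-th power of the partial zeta function is the part of the Euler
product of `ζ_L` over the primes above split ones, i.e. `ζ_L(s)` times `H(s) = ∏ (1 - N(P)^{-s})`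
over the remaining primes `P` (`partialZeta_splitPrimes_pow`). In a Galois extension `e` and `f` are
constant on the primes above `p`. So each remaining `P` is ramified, which happens finitely often,
or has `f ≥ 2`, so that `N(P) ≥ N(p)^2`. At most `n` primes lie over each `p`, so `H` converges
absolutely, and is holomorphic and nonzero, for `Re s > 1/2`. The simple pole of `ζ_L` therefore
survives.

The analytic input is the continuation of `ζ_L` to the left of `Re s = 1`. For a field of degree `d`
over `ℚ`, ideals of norm at most `x` in a class correspond, up to roots of unity, to lattice points
in a dilate of `normLeOne`. Estimating the volume near the boundary of that set gives the count with
error `O(x^(1 - 1/(2d)))`. The Mellin transform of the error is then holomorphic for `Re s > 1 -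
1/(2d)`. -/

/-! ### Lattice points and volume. -/

open MeasureTheory Module in
/-- The number of points of a `ℤ`-lattice in a bounded measurable set `Y`, multiplied by the
covolume, differs from the volume of `Y` by at most the volume of a neighbourhood of the
boundary of `Y`. -/
theorem ZLattice.exists_abs_card_inter_mul_covolume_sub_le {E : Type*} [NormedAddCommGroup E]
    [NormedSpace ℝ E] [FiniteDimensional ℝ E] [MeasurableSpace E] [BorelSpace E] (μ : Measure E)
    [μ.IsAddHaarMeasure] (L : Submodule ℤ E) [DiscreteTopology L] [IsZLattice ℝ L] :
    ∃ M : ℝ, 0 < M ∧ ∀ Y : Set E, MeasurableSet Y → Bornology.IsBounded Y →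
      |Nat.card (Y ∩ L : Set E) * ZLattice.covolume L μ - μ.real Y| ≤
        μ.real {x | ∃ y, ‖x - y‖ ≤ M ∧ ¬ (x ∈ Y ↔ y ∈ Y)} := by
  classical
  have : ProperSpace E := FiniteDimensional.proper_real E
  let b := Free.chooseBasis ℤ L
  let B := b.ofZLatticeBasis ℝ L
  set F := ZSpan.fundamentalDomain B with hFdef
  have hF : IsAddFundamentalDomain L F μ := ZLattice.isAddFundamentalDomain b μ
  have hFm : MeasurableSet F := ZSpan.fundamentalDomain_measurableSet B
  have hFb : Bornology.IsBounded F := ZSpan.fundamentalDomain_isBounded B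
  have hLspan : Submodule.span ℤ (Set.range B) = L := b.ofZLatticeBasis_span ℝ L
  obtain ⟨M₀, hM₀⟩ := hFb.exists_norm_le
  refine ⟨max M₀ 1, by positivity, fun Y hY hYb ↦ ?_⟩
  have hfin : (Y ∩ L : Set E).Finite :=
    Metric.finite_isBounded_inter_isClosed (s := (L : Set E)) ⟨inferInstance⟩ hYb
      (AddSubgroup.isClosed_of_discrete (H := L.toAddSubgroup))
  -- `W` is the disjoint union of the cells `ℓ + F` with `ℓ ∈ Y ∩ L`, so its volume is the number of
  -- points times the covolume. It differs from `Y` only at points whose cell has its lattice point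
  -- on the other side of the boundary.
  set W : Set E := ⋃ ℓ ∈ hfin.toFinset, (fun x ↦ x - ℓ) ⁻¹' F with hW
  have hpre (ℓ : E) : MeasurableSet ((fun x ↦ x - ℓ) ⁻¹' F) := (measurable_sub_const ℓ) hFm
  have hWm : MeasurableSet W := Finset.measurableSet_biUnion _ fun ℓ _ ↦ hpre ℓ
  have hμF : μ F ≠ ⊤ := hFb.measure_lt_top.ne
  have hpreμ (ℓ : E) : μ ((fun x ↦ x - ℓ) ⁻¹' F) = μ F := by
    simp_rw [sub_eq_add_neg]
    exact measure_preimage_add_right μ (-ℓ) F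
  have huniq {x ℓ ℓ' : E} (h : ℓ ∈ L) (h' : ℓ' ∈ L) (hx : x - ℓ ∈ F) (hx' : x - ℓ' ∈ F) :
      ℓ = ℓ' := by
    have := (ZSpan.exist_unique_vadd_mem_fundamentalDomain B x).unique
      (y₁ := ⟨-ℓ, by rw [hLspan]; exact neg_mem h⟩) (y₂ := ⟨-ℓ', by rw [hLspan]; exact neg_mem h'⟩)
      (show -ℓ + x ∈ F by rwa [neg_add_eq_sub])
      (show -ℓ' + x ∈ F by rwa [neg_add_eq_sub])
    simpa using this
  have hWμ : μ.real W = Nat.card (Y ∩ L : Set E) * ZLattice.covolume L μ := by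
    rw [hW, measureReal_biUnion_finset _ (fun ℓ _ ↦ hpre ℓ) (fun ℓ _ ↦ by rwa [hpreμ])]
    · simp only [measureReal_def, hpreμ, Finset.sum_const, nsmul_eq_mul,
        ZLattice.covolume_eq_measure_fundamentalDomain L μ hF]
      rw [Nat.card_coe_set_eq, Set.ncard_eq_toFinset_card _ hfin]
    · intro ℓ hℓ ℓ' hℓ' hne
      refine Set.disjoint_left.mpr fun x hx hx' ↦ hne (huniq ?_ ?_ hx hx')
      · exact (hfin.mem_toFinset.mp hℓ).2
      · exact (hfin.mem_toFinset.mp hℓ').2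
  have hWfin : μ W ≠ ⊤ := by
    refine ((measure_biUnion_finset_le _ _).trans_lt ?_).ne
    simpa [hpreμ] using ENNReal.mul_lt_top (by simp) hμF.lt_top
  rw [← hWμ]
  refine (abs_measureReal_sub_le_measureReal_symmDiff' hWm.nullMeasurableSet hY.nullMeasurableSet
    hWfin hYb.measure_lt_top.ne).trans (measureReal_mono ?_ ?_)
  · rintro x (⟨hxW, hxY⟩ | ⟨hxY, hxW⟩)
    · obtain ⟨ℓ, hℓ, hxℓ⟩ := Set.mem_iUnion₂.mp hxW
      exact ⟨ℓ, (hM₀ _ hxℓ).trans (le_max_left _ _), by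
        simp [hxY, (hfin.mem_toFinset.mp hℓ).1]⟩
    · obtain ⟨⟨v, hv⟩, hvF, -⟩ := ZSpan.exist_unique_vadd_mem_fundamentalDomain B x
      rw [hLspan] at hv
      have hvF' : x - -v ∈ F := by
        have : v + x ∈ F := hvF
        rwa [sub_neg_eq_add, add_comm]
      refine ⟨-v, (hM₀ _ hvF').trans (le_max_left _ _), fun h ↦ hxW ?_⟩
      exact Set.mem_iUnion₂.mpr ⟨-v, hfin.mem_toFinset.mpr ⟨h.mp hxY, neg_mem hv⟩, hvF'⟩
  · obtain ⟨R, hR⟩ := hYb.exists_norm_le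
    refine (Bornology.IsBounded.measure_lt_top (μ := μ) (isBounded_iff_forall_norm_le.mpr
      ⟨R + max M₀ 1, ?_⟩)).ne
    rintro x ⟨y, hxy, hne⟩
    by_cases hx : x ∈ Y
    · exact (hR x hx).trans (by simp)
    · have hy : y ∈ Y := by tauto
      calc ‖x‖ = ‖y + (x - y)‖ := by simp
        _ ≤ ‖y‖ + ‖x - y‖ := norm_add_le _ _
        _ ≤ _ := add_le_add (hR y hy) hxy

/-! ### Volume near the boundary of `normLeOne`. -/

theorem Real.abs_log_sub_log_le_div {a b δ : ℝ} (hδ : 0 < δ) (ha : δ ≤ a) (hb : δ ≤ b) :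
    |Real.log a - Real.log b| ≤ |a - b| / δ := by
  have key {a b : ℝ} (ha : δ ≤ a) (hb : δ ≤ b) : Real.log a - Real.log b ≤ |a - b| / δ := by
    have ha' := hδ.trans_le ha
    have hb' := hδ.trans_le hb
    rw [← Real.log_div ha'.ne' hb'.ne']
    calc Real.log (a / b) ≤ a / b - 1 := Real.log_le_sub_one_of_pos (by positivity)
      _ = (a - b) / b := by field_simp
      _ ≤ |a - b| / b := by gcongr; exact le_abs_self _
      _ ≤ |a - b| / δ := by gcongr
  refine abs_sub_le_iff.mpr ⟨key ha hb, ?_⟩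
  rw [abs_sub_comm]
  exact key hb ha

namespace NumberField.mixedEmbedding.fundamentalCone

open MeasureTheory ENNReal Module NumberField.InfinitePlace NumberField.Units
  dirichletUnitTheorem

variable {K : Type*} [Field K] [NumberField K]

open scoped Classical in
theorem abs_normAtPlace_sub_le (w : InfinitePlace K) (x y : mixedSpace K) :
    |normAtPlace w x - normAtPlace w y| ≤ ‖x - y‖ := by
  have hle (z : mixedSpace K) : normAtPlace w z ≤ ‖z‖ := by
    rw [norm_eq_sup'_normAtPlace]
    exact Finset.le_sup' (fun w ↦ normAtPlace w z) (Finset.mem_univ w)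
  have key (x y : mixedSpace K) : normAtPlace w x - normAtPlace w y ≤ ‖x - y‖ := by
    have := normAtPlace_add_le w (x - y) y
    rw [sub_add_cancel] at this
    linarith [hle (x - y)]
  refine abs_sub_le_iff.mpr ⟨key x y, ?_⟩
  rw [norm_sub_rev]
  exact key y x

theorem setLIntegral_univ_pi_comp_apply {ι : Type*} [Fintype ι] [DecidableEq ι] (I : ι → Set ℝ)
    (i : ι) {f : ℝ → ℝ≥0∞} (hf : Measurable f) :
    ∫⁻ x in Set.univ.pi I, f (x i) =
      (∫⁻ t in I i, f t) * ∏ j ∈ Finset.univ.erase i, volume (I j) := by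
  rw [volume_pi, Measure.restrict_pi_pi, lintegral_eq_lmarginal_univ 0,
    lmarginal_erase' _ (by fun_prop) (Finset.mem_univ i)]
  simp_rw [Function.update_self, lmarginal, lintegral_const, Measure.pi_univ,
    Measure.restrict_apply_univ]
  rw [Finset.prod_coe_sort (Finset.univ.erase i) fun j ↦ volume (I j)]

variable (K) in
open scoped Classical in
/-- A slab of width `2 * η` around a face of `paramSet K`. -/
noncomputable def faceSlab (w : InfinitePlace K) (c η : ℝ) : Set (realSpace K) :=
  Set.univ.pi fun w' ↦ if w' = w then Set.Icc (c - η) (c + η) else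
    if w' = w₀ then Set.Iic 1 else Set.Icc (-1) 2

theorem measurableSet_faceSlab (w : InfinitePlace K) (c η : ℝ) :
    MeasurableSet (faceSlab K w c η) := by
  refine MeasurableSet.univ_pi fun _ ↦ ?_
  split_ifs
  · exact measurableSet_Icc
  · exact measurableSet_Iic
  · exact measurableSet_Icc

-- The integrand depends only on the coordinate `w₀`, so the integral factors. If the thin side is
-- `w₀`, the integrand is at most `exp (2 * n)` there. Otherwise the thin side contributes the
-- factor `2 * η`, and the `w₀` integral over `(-∞, 1]` converges.
variable (K) in
theorem exists_setLIntegral_faceSlab_exp_le {n : ℕ} (hn : 0 < n) :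
    ∃ D : ℝ≥0∞, D ≠ ⊤ ∧ ∀ (w : InfinitePlace K) (c η : ℝ), c + η ≤ 2 →
      ∫⁻ x in faceSlab K w c η, .ofReal (Real.exp (x w₀ * n)) ≤ D * .ofReal η := by
  classical
  have hn' : 0 < (n : ℝ) := Nat.cast_pos.mpr hn
  have hmeas : Measurable fun t : ℝ ↦ ENNReal.ofReal (Real.exp (t * n)) := by fun_prop
  set A : ℝ≥0∞ := ∫⁻ t in Set.Iic (1 : ℝ), ENNReal.ofReal (Real.exp (t * n)) with hA
  have hAtop : A ≠ ⊤ := by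
    have := (integrableOn_exp_mul_Iic hn' 1).lintegral_lt_top
    simp_rw [mul_comm (n : ℝ)] at this
    exact this.ne
  set B : ℝ≥0∞ := .ofReal (Real.exp (2 * n)) with hB
  have h3 : (1 : ℝ≥0∞) ≤ ENNReal.ofReal 3 := by simp
  refine ⟨(A + B) * 2 * .ofReal 3 ^ Fintype.card (InfinitePlace K), by finiteness,
    fun w c η hcη ↦ ?_⟩
  rw [faceSlab, setLIntegral_univ_pi_comp_apply _ w₀ hmeas]
  have h2η : ENNReal.ofReal (c + η - (c - η)) = 2 * .ofReal η := by
    rw [show c + η - (c - η) = 2 * η by ring, ENNReal.ofReal_mul (by norm_num)]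
    simp
  by_cases hw : w = w₀
  · subst hw
    have h1 : ∏ j ∈ Finset.univ.erase w₀, volume (if j = w₀ then Set.Icc (c - η) (c + η) else
        if j = (w₀ : InfinitePlace K) then Set.Iic 1 else Set.Icc (-1 : ℝ) 2) ≤
          ENNReal.ofReal 3 ^ Fintype.card (InfinitePlace K) := by
      rw [Finset.prod_congr rfl (g := fun _ ↦ ENNReal.ofReal 3)]
      · rw [Finset.prod_const]
        exact pow_le_pow_right₀ h3 (Finset.card_le_univ _)
      · intro j hj
        rw [if_neg (Finset.ne_of_mem_erase hj), if_neg (Finset.ne_of_mem_erase hj)]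
        norm_num
    have h2 : ∫⁻ t in Set.Icc (c - η) (c + η), ENNReal.ofReal (Real.exp (t * n)) ≤
        B * (2 * .ofReal η) := by
      calc _ ≤ ∫⁻ t in Set.Icc (c - η) (c + η), B := by
            refine setLIntegral_mono measurable_const fun t ht ↦ ?_
            rw [hB]
            gcongr
            exact ht.2.trans hcη
        _ = _ := by rw [setLIntegral_const, Real.volume_Icc, h2η]
    rw [if_pos rfl]
    calc _ ≤ B * (2 * .ofReal η) * .ofReal 3 ^ Fintype.card (InfinitePlace K) := by gcongr
      _ ≤ (A + B) * (2 * .ofReal η) * .ofReal 3 ^ Fintype.card (InfinitePlace K) := by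
        gcongr; exact le_add_self
      _ = _ := by ring
  · rw [if_neg (Ne.symm hw), if_pos rfl,
      ← Finset.mul_prod_erase (Finset.univ.erase w₀) (a := w) _ (by simpa using hw), if_pos rfl,
      Real.volume_Icc, h2η]
    have h1 : ∏ j ∈ (Finset.univ.erase w₀).erase w, volume (if j = w then
        Set.Icc (c - η) (c + η) else
        if j = (w₀ : InfinitePlace K) then Set.Iic 1 else Set.Icc (-1 : ℝ) 2) ≤
          ENNReal.ofReal 3 ^ Fintype.card (InfinitePlace K) := by
      rw [Finset.prod_congr rfl (g := fun _ ↦ ENNReal.ofReal 3)]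
      · rw [Finset.prod_const]
        exact pow_le_pow_right₀ h3 (Finset.card_le_univ _)
      · intro j hj
        rw [if_neg (Finset.ne_of_mem_erase hj),
          if_neg (Finset.ne_of_mem_erase (Finset.mem_of_mem_erase hj))]
        norm_num
    calc _ ≤ A * (2 * .ofReal η * .ofReal 3 ^ Fintype.card (InfinitePlace K)) := by gcongr
      _ ≤ (A + B) * (2 * .ofReal η * .ofReal 3 ^ Fintype.card (InfinitePlace K)) := by
        gcongr; exact le_self_add
      _ = _ := by ring

-- In the coordinates of `expMapBasis` the Jacobian reduces to a constant times `exp (x w₀ * finrank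
-- ℚ K)`. Only the finiteness of `D` and its independence of `S` matter later.
variable (K) in
open scoped Classical in
theorem exists_volume_preimage_expMapBasis_image_eq :
    ∃ D : ℝ≥0∞, D ≠ ⊤ ∧ ∀ S : Set (realSpace K), MeasurableSet S →
      volume (normAtAllPlaces ⁻¹' (expMapBasis '' S)) =
        D * ∫⁻ x in S, .ofReal (Real.exp (x w₀ * finrank ℚ K)) := by
  refine ⟨2 ^ nrRealPlaces K * .ofReal (2 * Real.pi) ^ nrComplexPlaces K *
    ((2 : ℝ≥0∞)⁻¹ ^ nrComplexPlaces K * .ofReal (regulator K) * (finrank ℚ K)), by finiteness,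
    fun S hS ↦ ?_⟩
  have hm : MeasurableSet (normAtAllPlaces ⁻¹' (expMapBasis '' S)) := by
    refine MeasurableSet.preimage ?_ (continuous_normAtAllPlaces K).measurable
    exact hS.image_of_continuousOn_injOn (continuous_expMapBasis K).continuousOn
      (injective_expMapBasis K).injOn
  rw [volume_eq_two_pow_mul_two_pi_pow_mul_integral Set.preimage_image_preimage hm,
    normAtAllPlaces_image_preimage_expMapBasis, setLIntegral_expMapBasis_image hS (by fun_prop)]
  simp_rw [ENNReal.inv_mul_cancel_right
    (Finset.prod_ne_zero_iff.mpr fun _ _ ↦ ofReal_ne_zero_iff.mpr (expMapBasis_pos _ _))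
    (prod_ne_top fun _ _ ↦ ofReal_ne_top)]
  rw [← mul_assoc]

-- The inverse of `expMapBasis` is a coordinatewise logarithm followed by a linear map, and `log` is
-- `1/δ`-Lipschitz on `[δ, ∞)`.
variable (K) in
theorem exists_abs_sub_le_of_le_expMapBasis :
    ∃ C : ℝ, 0 < C ∧ ∀ (q q' : realSpace K) (δ : ℝ), 0 < δ → (∀ w, δ ≤ expMapBasis q w) →
      (∀ w, δ ≤ expMapBasis q' w) → ∀ ε, (∀ w, |expMapBasis q w - expMapBasis q' w| ≤ ε) →
        ∀ w, |q w - q' w| ≤ C * (ε / δ) := by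
  set e := (completeBasis K).equivFunL
  refine ⟨‖(e : realSpace K →L[ℝ] realSpace K)‖ * 2 + 1, by positivity,
    fun q q' δ hδ hq hq' ε hε w ↦ ?_⟩
  have hε0 : 0 ≤ ε := (abs_nonneg _).trans (hε w)
  have hv (q : realSpace K) (w : InfinitePlace K) :
      e.symm q w = w.mult * Real.log (expMapBasis q w) := by
    rw [expMapBasis_apply, expMap_apply, Real.log_exp, mul_inv_cancel_left₀ mult_coe_ne_zero]
    rfl
  have hmult (w : InfinitePlace K) : (w.mult : ℝ) ≤ 2 := by
    rw [mult]; split_ifs <;> norm_num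
  have h1 : ‖e.symm q - e.symm q'‖ ≤ 2 * (ε / δ) := by
    refine (pi_norm_le_iff_of_nonneg (by positivity)).mpr fun w ↦ ?_
    rw [Pi.sub_apply, hv, hv, ← mul_sub, Real.norm_eq_abs, abs_mul, Nat.abs_cast]
    refine mul_le_mul (hmult w) ?_ (abs_nonneg _) (by norm_num)
    exact (Real.abs_log_sub_log_le_div hδ (hq w) (hq' w)).trans (by gcongr; exact hε w)
  calc |q w - q' w| = ‖(q - q') w‖ := rfl
    _ ≤ ‖q - q'‖ := norm_le_pi_norm _ w
    _ = ‖(e : realSpace K →L[ℝ] realSpace K) (e.symm q - e.symm q')‖ := by simp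
    _ ≤ ‖(e : realSpace K →L[ℝ] realSpace K)‖ * (2 * (ε / δ)) :=
      ContinuousLinearMap.le_opNorm_of_le _ h1
    _ ≤ _ := by rw [← mul_assoc]; gcongr; linarith

-- Up to the scalar `exp (q w₀)`, `expMapBasis q` is its value at a point of a compact cube, where
-- its coordinates are continuous and positive.
variable (K) in
theorem exists_expMapBasis_mem_Icc :
    ∃ c C : ℝ, 0 < c ∧ 0 < C ∧ ∀ q ∈ paramSet K, ∀ w,
      c * Real.exp (q w₀) ≤ expMapBasis q w ∧ expMapBasis q w ≤ C * Real.exp (q w₀) := by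
  classical
  let P : Set (realSpace K) := Set.univ.pi fun w ↦ if w = w₀ then {0} else Set.Icc 0 1
  have hP : IsCompact P := by
    refine isCompact_univ_pi fun w ↦ ?_
    split_ifs
    · exact isCompact_singleton
    · exact isCompact_Icc
  have hP0 : P.Nonempty := Set.univ_pi_nonempty_iff.mpr (by aesop)
  have hcont (w : InfinitePlace K) : ContinuousOn (fun q ↦ expMapBasis q w) P :=
    ((continuous_apply w).comp (continuous_expMapBasis K)).continuousOn
  choose a ha ha' using fun w ↦ hP.exists_isMinOn hP0 (hcont w)
  choose b hb hb' using fun w ↦ hP.exists_isMaxOn hP0 (hcont w)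
  refine ⟨Finset.univ.inf' Finset.univ_nonempty fun w ↦ expMapBasis (a w) w,
    Finset.univ.sup' Finset.univ_nonempty fun w ↦ expMapBasis (b w) w, ?_, ?_, ?_⟩
  · simp [expMapBasis_pos]
  · simp [expMapBasis_pos]
  · intro q hq w
    have hq' : (fun i ↦ if i = w₀ then 0 else q i) ∈ P := by
      intro i _
      have := hq i trivial
      by_cases hi : i = w₀
      · simp [hi]
      · simp only [hi, if_false] at this ⊢
        exact Set.Ico_subset_Icc_self this
    rw [expMapBasis_apply'' q, Pi.smul_apply, smul_eq_mul, mul_comm (Real.exp _)]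
    constructor
    · gcongr
      exact (Finset.inf'_le _ (Finset.mem_univ w)).trans (ha' w hq')
    · gcongr
      exact (hb' w hq').trans
        (Finset.le_sup' (fun w ↦ expMapBasis (b w) w) (Finset.mem_univ w))

/-- Some coordinate of `q'` violates its constraint, so in that coordinate both points are within
`η` of the endpoint crossed. Since `η ≤ 1`, the other coordinates stay inside the wide sides of the
slab. -/
theorem exists_mem_faceSlab_of_mem_paramSet {q q' : realSpace K} {η : ℝ} (hη : η ≤ 1)
    (hq : q ∈ paramSet K) (hq' : q' ∉ paramSet K) (h : ∀ w, |q w - q' w| ≤ η) :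
    ∃ w, (q ∈ faceSlab K w 0 η ∧ q' ∈ faceSlab K w 0 η) ∨
      (q ∈ faceSlab K w 1 η ∧ q' ∈ faceSlab K w 1 η) := by
  classical
  have hqw (w : InfinitePlace K) : q w ∈ if w = w₀ then Set.Iic (0 : ℝ) else Set.Ico 0 1 :=
    hq w trivial
  obtain ⟨w, hw⟩ : ∃ w, q' w ∉ if w = w₀ then Set.Iic (0 : ℝ) else Set.Ico 0 1 := by
    simpa [Set.mem_univ_pi] using hq'
  have hη0 : 0 ≤ η := (abs_nonneg _).trans (h w)
  have hmem {c : ℝ} (h1 : q w ∈ Set.Icc (c - η) (c + η)) (h2 : q' w ∈ Set.Icc (c - η) (c + η)) :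
      q ∈ faceSlab K w c η ∧ q' ∈ faceSlab K w c η := by
    constructor <;> intro w' _ <;> by_cases hw' : w' = w
    · simpa [hw'] using h1
    · have h3 := hqw w'
      simp only [hw', if_false]
      split_ifs at h3 ⊢
      · exact h3.out.trans zero_le_one
      · exact ⟨by linarith [h3.1], by linarith [h3.2]⟩
    · simpa [hw'] using h2
    · have h3 := hqw w'
      have h4 := abs_le.mp (h w')
      simp only [hw', if_false]
      split_ifs at h3 ⊢
      · rw [Set.mem_Iic] at h3 ⊢; linarith
      · exact ⟨by linarith [h3.1], by linarith [h3.2]⟩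
  have h3 := hqw w
  have h4 := abs_le.mp (h w)
  refine ⟨w, ?_⟩
  by_cases hw0 : w = w₀
  · rw [if_pos hw0] at h3 hw
    rw [Set.mem_Iic] at h3
    rw [Set.mem_Iic, not_le] at hw
    exact .inl (hmem ⟨by linarith, by linarith⟩ ⟨by linarith, by linarith⟩)
  · rw [if_neg hw0] at h3 hw
    rw [Set.mem_Ico, not_and_or, not_le, not_lt] at hw
    obtain hw | hw := hw
    · exact .inl (hmem ⟨by linarith [h3.1], by linarith⟩ ⟨by linarith [h3.1], by linarith⟩)
    · exact .inr (hmem ⟨by linarith, by linarith [h3.2]⟩ ⟨by linarith, by linarith [h3.2]⟩)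

end NumberField.mixedEmbedding.fundamentalCone

namespace NumberField.mixedEmbedding.fundamentalCone

open MeasureTheory ENNReal Module NumberField.InfinitePlace NumberField.Units
  dirichletUnitTheorem

variable (K : Type*) [Field K] [NumberField K]

-- Logarithmic coordinates degenerate at the origin, so one cuts at scale `r = √ε`. Near the origin
-- a ball of radius `O(r)` suffices. Elsewhere all coordinates are at least `r`, so a displacement
-- `ε` moves the parameters by `O(ε / r) = O(r)`, and the points lie in face slabs of volume `O(r)`.
open scoped Classical in
theorem exists_volume_thickened_boundary_normLeOne_le :
    ∃ C ε₀ : ℝ, 0 < C ∧ 0 < ε₀ ∧ ∀ ε, 0 < ε → ε ≤ ε₀ →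
      volume {x : mixedSpace K | ∃ y, ‖x - y‖ ≤ ε ∧ ¬ (x ∈ normLeOne K ↔ y ∈ normLeOne K)} ≤
        .ofReal (C * √ε) := by
  obtain ⟨D, hD, hvol⟩ := exists_volume_preimage_expMapBasis_image_eq K
  obtain ⟨D', hD', hslab⟩ := exists_setLIntegral_faceSlab_exp_le K (finrank_pos (R := ℚ) (M := K))
  obtain ⟨C₁, hC₁, hlip⟩ := exists_abs_sub_le_of_le_expMapBasis K
  obtain ⟨c, C₂, hc, hC₂, hbd⟩ := exists_expMapBasis_mem_Icc K
  set R : ℝ := C₂ * (2 / c) + 1 with hR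
  have hR0 : 0 < R := by positivity
  set V := volume (Metric.ball (0 : mixedSpace K) 1)
  have hV : V ≠ ⊤ := measure_ball_lt_top.ne
  set A : ℝ≥0∞ := .ofReal (R ^ finrank ℚ K) * V +
    Fintype.card (InfinitePlace K) * (2 * (D * D' * .ofReal C₁)) with hA
  have hAtop : A ≠ ⊤ := by finiteness
  -- The bound on `ε` ensures `r ≤ 1` and slab width parameter `C₁ * r ≤ 1`.
  refine ⟨A.toReal + 1, (min 1 C₁⁻¹) ^ 2, by positivity, by positivity, fun ε hε hε₀ ↦ ?_⟩
  set r := √ε with hr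
  have hr0 : 0 < r := Real.sqrt_pos.mpr hε
  have hr2 : ε = r ^ 2 := (Real.sq_sqrt hε.le).symm
  have hrle : r ≤ min 1 C₁⁻¹ := by
    rw [hr]
    exact Real.sqrt_le_iff.mpr ⟨by positivity, hε₀⟩
  have hr1 : r ≤ 1 := hrle.trans (min_le_left _ _)
  have hη : C₁ * r ≤ 1 := by
    calc C₁ * r ≤ C₁ * C₁⁻¹ := by gcongr; exact hrle.trans (min_le_right _ _)
      _ = 1 := mul_inv_cancel₀ hC₁.ne'
  have hεr : ε ≤ r := by rw [hr2]; nlinarith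
  have hmem {x : mixedSpace K} : x ∈ normLeOne K ↔ ∃ q ∈ paramSet K, expMapBasis q =
      normAtAllPlaces x := by
    rw [normLeOne_eq_preimage]; rfl
  have key (a b : mixedSpace K) (hab : ‖a - b‖ ≤ ε) (ha : a ∈ normLeOne K)
      (hb : b ∉ normLeOne K) : ‖a‖ ≤ (R - 1) * r ∨ ∃ w, ∃ i ∈ ({0, 1} : Set ℝ),
        a ∈ normAtAllPlaces ⁻¹' (expMapBasis '' faceSlab K w i (C₁ * r)) ∧
        b ∈ normAtAllPlaces ⁻¹' (expMapBasis '' faceSlab K w i (C₁ * r)) := by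
    obtain ⟨q, hq, hqa⟩ := hmem.mp ha
    -- The factor `2` leaves room: if `a` has all coordinates at least `2 * r`, those of `b` are at
    -- least `2 * r - ε ≥ r`.
    by_cases hsmall : c * Real.exp (q w₀) ≤ 2 * r
    · left
      have : Real.exp (q w₀) ≤ 2 / c * r := by
        rw [div_mul_eq_mul_div, le_div_iff₀ hc, mul_comm]; exact hsmall
      rw [norm_eq_sup'_normAtPlace]
      refine Finset.sup'_le _ _ fun w _ ↦ ?_
      rw [← normAtAllPlaces_apply, ← hqa]
      calc expMapBasis q w ≤ C₂ * Real.exp (q w₀) := (hbd q hq w).2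
        _ ≤ C₂ * (2 / c * r) := by gcongr
        _ = (R - 1) * r := by rw [hR]; ring
    · right
      rw [not_le] at hsmall
      have haw (w : InfinitePlace K) : 2 * r ≤ expMapBasis q w := hsmall.le.trans (hbd q hq w).1
      have hdist (w : InfinitePlace K) : |normAtPlace w a - normAtPlace w b| ≤ ε :=
        (abs_normAtPlace_sub_le w a b).trans hab
      have hbw (w : InfinitePlace K) : r ≤ normAtPlace w b := by
        have h1 := (abs_le.mp (hdist w)).2
        have h2 := haw w
        rw [hqa, normAtAllPlaces_apply] at h2
        linarith
      obtain ⟨q', hq'⟩ : ∃ q', expMapBasis q' = normAtAllPlaces b := by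
        refine ⟨expMapBasis.symm (normAtAllPlaces b), expMapBasis.right_inv ?_⟩
        have : expMapBasis.target = (Set.univ.pi fun _ ↦ Set.Ioi 0 : Set (realSpace K)) := by
          rw [← expMap_target]; rfl
        rw [this]
        exact fun w _ ↦ hr0.trans_le (hbw w)
      have hqP : q' ∉ paramSet K := fun h ↦ hb (hmem.mpr ⟨q', h, hq'⟩)
      have hqq : ∀ w, |q w - q' w| ≤ C₁ * r := by
        have := hlip q q' r hr0 (fun w ↦ by linarith [haw w]) (fun w ↦ by rw [hq']; exact hbw w) ε
          (fun w ↦ by rw [hq', hqa]; exact hdist w)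
        have h2 : ε / r = r := by rw [hr2]; field_simp
        rwa [h2] at this
      obtain ⟨w, ⟨h1, h2⟩ | ⟨h1, h2⟩⟩ := exists_mem_faceSlab_of_mem_paramSet hη hq hqP hqq
      · exact ⟨w, 0, by simp, ⟨q, h1, hqa⟩, ⟨q', h2, hq'⟩⟩
      · exact ⟨w, 1, by simp, ⟨q, h1, hqa⟩, ⟨q', h2, hq'⟩⟩
  have hsub : {x : mixedSpace K | ∃ y, ‖x - y‖ ≤ ε ∧ ¬ (x ∈ normLeOne K ↔ y ∈ normLeOne K)} ⊆
      Metric.closedBall 0 (R * r) ∪ ⋃ w : InfinitePlace K,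
        (normAtAllPlaces ⁻¹' (expMapBasis '' faceSlab K w 0 (C₁ * r)) ∪
        normAtAllPlaces ⁻¹' (expMapBasis '' faceSlab K w 1 (C₁ * r))) := by
    rintro x ⟨y, hxy, hne⟩
    by_cases hx : x ∈ normLeOne K
    · have hy : y ∉ normLeOne K := by tauto
      obtain h | ⟨w, i, hi, h, -⟩ := key x y hxy hx hy
      · left
        rw [mem_closedBall_zero_iff]
        exact h.trans (by gcongr; linarith)
      · right
        refine Set.mem_iUnion.mpr ⟨w, ?_⟩
        obtain rfl | rfl := hi
        · exact .inl h
        · exact .inr h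
    · have hy : y ∈ normLeOne K := by tauto
      obtain h | ⟨w, i, hi, -, h⟩ := key y x (by rwa [norm_sub_rev]) hy hx
      · left
        rw [mem_closedBall_zero_iff]
        calc ‖x‖ = ‖y + (x - y)‖ := by simp
          _ ≤ ‖y‖ + ‖x - y‖ := norm_add_le _ _
          _ ≤ (R - 1) * r + r := add_le_add h (hxy.trans hεr)
          _ = R * r := by ring
      · right
        refine Set.mem_iUnion.mpr ⟨w, ?_⟩
        obtain rfl | rfl := hi
        · exact .inl h
        · exact .inr h
  have hslab' (w : InfinitePlace K) {i : ℝ} (hi : i ≤ 1) :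
      volume (normAtAllPlaces ⁻¹' (expMapBasis '' faceSlab K w i (C₁ * r)) :
        Set (mixedSpace K)) ≤ D * D' * .ofReal C₁ * .ofReal r := by
    rw [hvol _ (measurableSet_faceSlab w i _), mul_assoc, mul_assoc, ← ENNReal.ofReal_mul hC₁.le]
    gcongr
    exact hslab w i _ (by linarith)
  have hball : volume (Metric.closedBall (0 : mixedSpace K) (R * r)) ≤
      .ofReal (R ^ finrank ℚ K) * V * .ofReal r := by
    rw [Measure.addHaar_closedBall _ _ (by positivity), mixedEmbedding.finrank, mul_pow,
      ENNReal.ofReal_mul (by positivity), mul_assoc, mul_assoc, mul_comm V]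
    gcongr
    exact pow_le_of_le_one hr0.le hr1 finrank_pos.ne'
  calc _ ≤ _ := measure_mono hsub
    _ ≤ _ := measure_union_le _ _
    _ ≤ .ofReal (R ^ finrank ℚ K) * V * .ofReal r +
        ∑ w : InfinitePlace K, (2 * (D * D' * .ofReal C₁)) * .ofReal r := by
      refine add_le_add hball ((measure_iUnion_fintype_le _ _).trans ?_)
      refine Finset.sum_le_sum fun w _ ↦ (measure_union_le _ _).trans ?_
      rw [mul_assoc, two_mul]
      exact add_le_add (hslab' w zero_le_one) (hslab' w le_rfl)
    _ = A * .ofReal r := by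
      rw [hA, Finset.sum_const, Finset.card_univ, nsmul_eq_mul]; ring
    _ ≤ .ofReal (A.toReal + 1) * .ofReal r := by
      gcongr
      rw [← ENNReal.ofReal_toReal hAtop]
      exact ENNReal.ofReal_le_ofReal (by simp)
    _ = _ := by rw [ENNReal.ofReal_mul (by positivity)]

/-! ### Lattice points in the fundamental cone. -/

open Filter Asymptotics in
open scoped nonZeroDivisors Pointwise in
/-- The number of points of norm at most `x` of an ideal lattice in the fundamental cone, with a
power-saving error term. -/
theorem exists_card_idealSet_sub_isBigO (J : (Ideal (𝓞 K))⁰) :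
    ∃ c : ℝ, (fun x : ℝ ↦
      (Nat.card {a : idealSet K J // mixedEmbedding.norm (a : mixedSpace K) ≤ x} : ℝ) - c * x)
        =O[atTop] fun x ↦ x ^ (1 - (2 * finrank ℚ K : ℝ)⁻¹) := by
  classical
  set n := finrank ℚ K with hn
  have hn0 : n ≠ 0 := finrank_pos.ne'
  set L := mixedEmbedding.idealLattice K (FractionalIdeal.mk0 K J)
  obtain ⟨C, ε₀, hC, hε₀, hvol⟩ := exists_volume_thickened_boundary_normLeOne_le K
  obtain ⟨M, hM, hcount⟩ := ZLattice.exists_abs_card_inter_mul_covolume_sub_le volume L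
  set cov := ZLattice.covolume L
  have hcov : 0 < cov := ZLattice.covolume_pos L
  refine ⟨volume.real (normLeOne K) / cov, ?_⟩
  rw [isBigO_iff]
  refine ⟨C * √M / cov, ?_⟩
  filter_upwards [eventually_gt_atTop 0, eventually_ge_atTop ((M / ε₀) ^ n)] with x hx0 hx
  -- The norm is homogeneous of degree `n`, so `t • normLeOne K` is the part of the cone with norm
  -- at most `x`. Its boundary layer of width `M` is the layer of width `M / t` scaled by `t`, of
  -- volume `O(x * √(M / t))`.
  set t : ℝ := x ^ ((n : ℝ)⁻¹) with ht
  have ht0 : 0 < t := Real.rpow_pos_of_pos hx0 _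
  have htn : t ^ n = x := Real.rpow_inv_natCast_pow hx0.le hn0
  have hMt : M / t ≤ ε₀ := by
    rw [div_le_iff₀ ht0, mul_comm, ← div_le_iff₀ hε₀]
    exact le_of_pow_le_pow_left₀ hn0 ht0.le (by rw [htn]; exact hx)
  have hmem {y : mixedSpace K} : y ∈ t • normLeOne K ↔
      y ∈ fundamentalCone K ∧ mixedEmbedding.norm y ≤ x := by
    rw [Set.mem_smul_set_iff_inv_smul_mem₀ ht0.ne', mem_normLeOne,
      smul_mem_iff_mem (inv_ne_zero ht0.ne'), mixedEmbedding.norm_smul, ← hn,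
      abs_of_pos (inv_pos.mpr ht0), inv_pow, htn, inv_mul_le_iff₀ hx0, mul_one]
  have hcard : Nat.card {a : idealSet K J // mixedEmbedding.norm (a : mixedSpace K) ≤ x} =
      Nat.card (t • normLeOne K ∩ L : Set (mixedSpace K)) := by
    refine Nat.card_congr ((Equiv.subtypeSubtypeEquivSubtypeInter (· ∈ idealSet K J)
      (mixedEmbedding.norm · ≤ x)).trans (Equiv.subtypeEquivProp ?_))
    ext y
    change (y ∈ fundamentalCone K ∧ y ∈ L) ∧ _ ↔ y ∈ t • normLeOne K ∧ y ∈ L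
    rw [hmem]
    tauto
  have hmeas : MeasurableSet (t • normLeOne K) := (measurableSet_normLeOne K).const_smul₀ t
  have hvolt (S : Set (mixedSpace K)) : volume.real (t • S) = x * volume.real S := by
    rw [measureReal_def, Measure.addHaar_smul, mixedEmbedding.finrank, ← hn, htn,
      abs_of_pos hx0, ENNReal.toReal_mul, ENNReal.toReal_ofReal hx0.le, measureReal_def]
  have hbad : {y : mixedSpace K | ∃ z, ‖y - z‖ ≤ M ∧ ¬ (y ∈ t • normLeOne K ↔
      z ∈ t • normLeOne K)} = t • {y : mixedSpace K | ∃ z, ‖y - z‖ ≤ M / t ∧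
        ¬ (y ∈ normLeOne K ↔ z ∈ normLeOne K)} := by
    ext y
    simp only [Set.mem_smul_set_iff_inv_smul_mem₀ ht0.ne', Set.mem_ofPred_eq]
    constructor
    · rintro ⟨z, hz, h⟩
      refine ⟨t⁻¹ • z, ?_, h⟩
      rw [← smul_sub, _root_.norm_smul, norm_inv, Real.norm_of_nonneg ht0.le, inv_mul_eq_div]
      gcongr
    · rintro ⟨z, hz, h⟩
      refine ⟨t • z, ?_, by rwa [inv_smul_smul₀ ht0.ne']⟩
      rw [← smul_inv_smul₀ ht0.ne' y, ← smul_sub, _root_.norm_smul, Real.norm_of_nonneg ht0.le,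
        mul_comm, ← le_div_iff₀ ht0]
      exact hz
  have h1 := hcount _ hmeas ((isBounded_normLeOne K).smul₀ t)
  rw [hbad, hvolt, hvolt] at h1
  have h2 : volume.real {y : mixedSpace K | ∃ z, ‖y - z‖ ≤ M / t ∧
      ¬ (y ∈ normLeOne K ↔ z ∈ normLeOne K)} ≤ C * √(M / t) :=
    ENNReal.toReal_le_of_le_ofReal (by positivity) (hvol _ (by positivity) hMt)
  have h3 : x * √(M / t) = √M * x ^ (1 - (2 * n : ℝ)⁻¹) := by
    rw [Real.sqrt_div hM.le, Real.sqrt_eq_rpow t, ht, ← Real.rpow_mul hx0.le,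
      Real.rpow_sub hx0, Real.rpow_one, show (n : ℝ)⁻¹ * (1 / 2) = (2 * n : ℝ)⁻¹ by
        rw [mul_inv]; ring]
    ring
  rw [hcard, Real.norm_of_nonneg (Real.rpow_nonneg hx0.le _), Real.norm_eq_abs]
  have h4 : (Nat.card (t • normLeOne K ∩ L : Set (mixedSpace K)) : ℝ) -
      volume.real (normLeOne K) / cov * x = (Nat.card (t • normLeOne K ∩ L : Set (mixedSpace K)) *
        cov - x * volume.real (normLeOne K)) / cov := by
    field_simp
  rw [h4, abs_div, abs_of_pos hcov, div_mul_eq_mul_div]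
  gcongr
  calc _ ≤ _ := h1
    _ ≤ x * (C * √(M / t)) := by gcongr
    _ = _ := by rw [mul_left_comm, h3, mul_assoc]

end NumberField.mixedEmbedding.fundamentalCone

/-! ### Continuation of a Dirichlet series from its partial sums. -/

open Filter Asymptotics MeasureTheory Finset in
/-- If the partial sums of a nonnegative sequence `f` satisfy `∑ k ≤ t, f k = l * t + O(t ^ θ)`,
then `LSeries f s - l * s / (s - 1)` extends holomorphically to the half-plane `θ < Re s`. -/
theorem LSeries_eq_add_of_sum_sub_isBigO {f : ℕ → ℝ} (hf : ∀ n, 0 ≤ f n) {l θ : ℝ} (hθ : θ ≤ 1)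
    (hO : (fun t : ℝ ↦ ∑ k ∈ Icc 1 ⌊t⌋₊, f k - l * t) =O[atTop] fun t ↦ t ^ θ) :
    ∃ g : ℂ → ℂ, DifferentiableOn ℂ g {s | θ < s.re} ∧ ∀ s : ℂ, 1 < s.re →
      LSeriesSummable (fun n ↦ (f n : ℂ)) s ∧
      LSeries (fun n ↦ (f n : ℂ)) s = l * s / (s - 1) + g s := by
  set S : ℝ → ℂ := fun t ↦ ∑ k ∈ Icc 1 ⌊t⌋₊, (f k : ℂ) with hS
  -- Cutting the main term off below `1` makes `S - T` vanish near `0`, so only the growth at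
  -- infinity restricts its Mellin transform. By Abel summation the main term contributes `s * ∫_1^∞
  -- l * t^(-s) = l * s / (s - 1)`.
  set T : ℝ → ℂ := (Set.Ici (1 : ℝ)).indicator fun t ↦ (l : ℂ) * t with hT
  have hTI {t : ℝ} (ht : 1 ≤ t) : T t = l * t := Set.indicator_of_mem (Set.mem_Ici.mpr ht) _
  have hS0 {t : ℝ} (ht : t < 1) : S t = 0 := by
    simp [hS, Nat.floor_eq_zero.mpr ht]
  have hT0 {t : ℝ} (ht : t < 1) : T t = 0 := by
    simp [hT, ht]
  have hloc : LocallyIntegrableOn (fun t ↦ S t - T t) (Set.Ioi 0) := by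
    refine LocallyIntegrableOn.sub ?_ ?_
    · have := locallyIntegrableOn_mul_sum_Icc (fun k ↦ (f k : ℂ)) (m := 1) le_rfl (g := fun _ ↦ 1)
        (a := 0) (locallyIntegrableOn_const 1)
      simp_rw [one_mul] at this
      exact this.mono_set Set.Ioi_subset_Ici_self
    · exact LocallyIntegrable.locallyIntegrableOn (LocallyIntegrable.indicator
        (Continuous.locallyIntegrable (by fun_prop)) measurableSet_Ici) _
  have htop : (fun t ↦ S t - T t) =O[atTop] fun t : ℝ ↦ t ^ (-(-θ)) := by
    rw [neg_neg]
    refine (hO.norm_left.congr' ?_ EventuallyEq.rfl).of_norm_left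
    filter_upwards [eventually_ge_atTop 1] with t ht
    rw [hTI ht, hS, ← Complex.norm_real]
    push_cast
    rfl
  have hbot (b : ℝ) : (fun t ↦ S t - T t) =O[nhdsWithin 0 (Set.Ioi 0)] fun t : ℝ ↦ t ^ (-b) := by
    refine IsBigO.congr' (isBigO_zero _ _) ?_ EventuallyEq.rfl
    filter_upwards [nhdsWithin_le_nhds (Iio_mem_nhds zero_lt_one)] with t ht
    rw [hS0 ht, hT0 ht, sub_zero]
  have hO1 : (fun n : ℕ ↦ ∑ k ∈ Icc 1 n, f k) =O[atTop] fun n ↦ (n : ℝ) ^ (1 : ℝ) := by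
    have h1 : (fun t : ℝ ↦ ∑ k ∈ Icc 1 ⌊t⌋₊, f k) =O[atTop] fun t ↦ t ^ (1 : ℝ) := by
      have h2 : (fun t : ℝ ↦ t ^ θ) =O[atTop] fun t ↦ t ^ (1 : ℝ) := by
        refine IsBigO.of_bound 1 ?_
        filter_upwards [eventually_ge_atTop 1] with t ht
        rw [Real.norm_of_nonneg (by positivity), Real.norm_of_nonneg (by positivity), one_mul]
        exact Real.rpow_le_rpow_of_exponent_le ht hθ
      have h3 : (fun t : ℝ ↦ l * t) =O[atTop] fun t ↦ t ^ (1 : ℝ) := by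
        simp_rw [Real.rpow_one]
        exact (isBigO_refl _ _).const_mul_left l
      simpa using (hO.trans h2).add h3
    have := h1.comp_tendsto tendsto_natCast_atTop_atTop
    simpa [Function.comp_def] using this
  refine ⟨fun s ↦ s * mellin (fun t ↦ S t - T t) (-s), ?_, fun s hs ↦ ?_⟩
  · intro s hs
    refine (differentiableAt_id.mul (DifferentiableAt.comp s (g := mellin _) ?_
      differentiableAt_id.neg)).differentiableWithinAt
    exact mellin_differentiableAt_of_isBigO_rpow hloc htop (by simpa using hs)
      (hbot (-s.re - 1)) (by simp)
  · refine ⟨LSeriesSummable_of_sum_norm_bigO_and_nonneg hO1 hf zero_le_one hs, ?_⟩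
    have hs1 : s - 1 ≠ 0 := by
      intro h
      rw [sub_eq_zero.mp h] at hs
      simp at hs
    have hconv : MellinConvergent (fun t ↦ S t - T t) (-s) :=
      mellinConvergent_of_isBigO_rpow hloc htop (by simpa using hθ.trans_lt hs)
        (hbot (-s.re - 1)) (by simp)
    have hsub : Set.Ioi (1 : ℝ) ⊆ Set.Ioi 0 := Set.Ioi_subset_Ioi zero_le_one
    have hmel : mellin (fun t ↦ S t - T t) (-s) =
        ∫ t in Set.Ioi (1 : ℝ), (t : ℂ) ^ (-s - 1) • (S t - T t) := by
      rw [mellin, ← integral_Ici_eq_integral_Ioi (x := (1 : ℝ))]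
      refine setIntegral_eq_of_subset_of_forall_sdiff_eq_zero measurableSet_Ioi
        (Set.Ici_subset_Ioi.mpr zero_lt_one) fun t ht ↦ ?_
      have : t < 1 := by simpa using ht.2
      rw [hS0 this, hT0 this, sub_zero, smul_zero]
    have hlin : IntegrableOn (fun t : ℝ ↦ l * (t : ℂ) ^ (-s)) (Set.Ioi 1) :=
      (integrableOn_Ioi_cpow_of_lt (by simpa using hs) zero_lt_one).const_mul _
    have hlint : ∫ t in Set.Ioi (1 : ℝ), l * (t : ℂ) ^ (-s) = l / (s - 1) := by
      rw [integral_const_mul, integral_Ioi_cpow_of_lt (by simpa using hs) zero_lt_one]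
      have : -s + 1 ≠ 0 := by rwa [neg_add_eq_sub, ← neg_sub, neg_ne_zero]
      simp only [Complex.ofReal_one, Complex.one_cpow]
      field_simp
      ring
    beta_reduce
    rw [LSeries_eq_mul_integral_of_nonneg f zero_le_one hs hO1 hf, hmel, mul_comm (l : ℂ) s,
      mul_div_assoc, ← mul_add, ← hlint, ← integral_add hlin (hconv.mono_set hsub)]
    congr 1
    refine setIntegral_congr_fun measurableSet_Ioi fun t ht ↦ ?_
    have ht' : (t : ℂ) ≠ 0 := by
      exact_mod_cast (zero_lt_one.trans ht).ne'
    have h1 : (t : ℂ) ^ (-s) = t * (t : ℂ) ^ (-s - 1) := by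
      rw [Complex.cpow_sub _ _ ht', Complex.cpow_one]
      field_simp
    simp only [hTI (le_of_lt ht), smul_eq_mul, h1, neg_add']
    ring

/-! ### Counting ideals. -/

namespace NumberField.Ideal

open Filter Asymptotics Module NumberField.Units
  mixedEmbedding mixedEmbedding.fundamentalCone nonZeroDivisors Topology

open _root_.Ideal Submodule

variable (K : Type*) [Field K] [NumberField K]

/-- Multiplication by `J`, of class `C⁻¹`, turns ideals of class `C` into principal multiples of
`J`. -/
theorem card_norm_le_and_mk_eq {C : ClassGroup (𝓞 K)} {J : (Ideal (𝓞 K))⁰} (s : ℝ)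
    (hJ : ClassGroup.mk0 J = C⁻¹) :
    Nat.card {I : (Ideal (𝓞 K))⁰ // absNorm (I : Ideal (𝓞 K)) ≤ s ∧ ClassGroup.mk0 I = C} =
      Nat.card {I : (Ideal (𝓞 K))⁰ // (J : Ideal (𝓞 K)) ∣ I ∧ IsPrincipal (I : Ideal (𝓞 K)) ∧
        absNorm (I : Ideal (𝓞 K)) ≤ s * absNorm (J : Ideal (𝓞 K))} := by
  simp_rw [← nonZeroDivisors_dvd_iff_dvd_coe]
  refine Nat.card_congr (((Equiv.dvd J).subtypeEquiv fun I ↦ ?_).trans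
    (Equiv.subtypeSubtypeEquivSubtypeInter (fun I : (Ideal (𝓞 K))⁰ ↦ J ∣ I) _))
  rw [← ClassGroup.mk0_eq_one_iff (SetLike.coe_mem _)]
  simp_rw [Equiv.dvd_apply, Submonoid.coe_mul, ← Submonoid.mul_def, _root_.map_mul, hJ,
    inv_mul_eq_one, Nat.cast_mul, mul_comm s, eq_comm, and_comm, and_congr_left_iff]
  exact fun _ ↦
    (mul_le_mul_iff_of_pos_left (Nat.cast_pos.mpr (absNorm_pos_of_nonZeroDivisors J))).symm

/-- The number of nonzero ideals of norm at most `x` in a given class, with a power-saving error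
term. -/
theorem exists_card_norm_le_and_mk_eq_sub_isBigO (C : ClassGroup (𝓞 K)) :
    ∃ c : ℝ, (fun x : ℝ ↦ (Nat.card {I : (Ideal (𝓞 K))⁰ //
      absNorm (I : Ideal (𝓞 K)) ≤ x ∧ ClassGroup.mk0 I = C} : ℝ) - c * x)
        =O[atTop] fun x ↦ x ^ (1 - (2 * finrank ℚ K : ℝ)⁻¹) := by
  obtain ⟨J, hJ⟩ := ClassGroup.mk0_surjective C⁻¹
  obtain ⟨c, hc⟩ := exists_card_idealSet_sub_isBigO K J
  set N : ℝ := ((absNorm (J : Ideal (𝓞 K)) : ℕ) : ℝ)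
  have hN : 0 < N := Nat.cast_pos.mpr (absNorm_pos_of_nonZeroDivisors J)
  have hw : (torsionOrder K : ℝ) ≠ 0 := Nat.cast_ne_zero.mpr (torsionOrder_ne_zero K)
  -- A principal ideal has `torsionOrder K` generators in the cone; `N` comes from the norm bound `x
  -- * N` after multiplying by `J`.
  refine ⟨(torsionOrder K : ℝ)⁻¹ * (c * N), ?_⟩
  have h1 := (hc.comp_tendsto (tendsto_id.atTop_mul_const hN)).const_mul_left
    (torsionOrder K : ℝ)⁻¹
  refine (h1.congr_left fun x ↦ ?_).trans ?_
  · simp only [Function.comp_apply, id_eq]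
    rw [card_norm_le_and_mk_eq K x hJ, ← card_isPrincipal_dvd_norm_le]
    push_cast
    field_simp
    rfl
  · refine IsBigO.of_bound (N ^ (1 - (2 * finrank ℚ K : ℝ)⁻¹)) ?_
    filter_upwards [eventually_ge_atTop 0] with x hx
    simp only [Function.comp_apply, id_eq]
    rw [Real.mul_rpow hx hN.le, norm_mul, mul_comm, Real.norm_of_nonneg (Real.rpow_nonneg hN.le _)]

/-- The number of nonzero ideals of norm at most `x`, with a power-saving error term. -/
theorem card_norm_le_sub_isBigO :
    (fun x : ℝ ↦ (Nat.card {I : (Ideal (𝓞 K))⁰ // absNorm (I : Ideal (𝓞 K)) ≤ x} : ℝ) -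
      dedekindZeta_residue K * x) =O[atTop] fun x ↦ x ^ (1 - (2 * finrank ℚ K : ℝ)⁻¹) := by
  classical
  choose c hc using exists_card_norm_le_and_mk_eq_sub_isBigO K
  have hsum : (fun x : ℝ ↦ (Nat.card {I : (Ideal (𝓞 K))⁰ // absNorm (I : Ideal (𝓞 K)) ≤ x} : ℝ) -
      (∑ C, c C) * x) =O[atTop] fun x ↦ x ^ (1 - (2 * finrank ℚ K : ℝ)⁻¹) := by
    refine (IsBigO.sum (s := Finset.univ) fun C _ ↦ hc C).congr' ?_ EventuallyEq.rfl
    filter_upwards [eventually_ge_atTop 0] with s hs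
    have : Fintype {I : (Ideal (𝓞 K))⁰ // absNorm (I : Ideal (𝓞 K)) ≤ s} := by
      simp_rw [← Nat.le_floor_iff hs]
      refine @Fintype.ofFinite _ (finite_setOfPred_absNorm_le₀ ⌊s⌋₊)
    let e := fun C : ClassGroup (𝓞 K) ↦ Equiv.subtypeSubtypeEquivSubtypeInter
      (fun I : (Ideal (𝓞 K))⁰ ↦ absNorm I.1 ≤ s) (fun I ↦ ClassGroup.mk0 I = C)
    rw [Finset.sum_apply, Finset.sum_sub_distrib, ← Finset.sum_mul]
    simp_rw [← Nat.card_congr (e _),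
      Nat.card_eq_fintype_card, Fintype.subtype_card]
    rw [Fintype.card, Finset.card_eq_sum_card_fiberwise (f := fun I ↦ ClassGroup.mk0 I.1)
      (t := Finset.univ) (fun _ _ ↦ Finset.mem_univ _), Nat.cast_sum]
  -- The constants `c C` are only known to exist; comparing limits identifies their sum with the
  -- residue.
  have hlim : Tendsto (fun x : ℝ ↦ (Nat.card {I : (Ideal (𝓞 K))⁰ //
      absNorm (I : Ideal (𝓞 K)) ≤ x} : ℝ) / x) atTop (𝓝 (∑ C, c C)) := by
    have h1 : (fun x : ℝ ↦ x ^ (1 - (2 * finrank ℚ K : ℝ)⁻¹)) =o[atTop] fun x : ℝ ↦ x := by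
      have hn : (0 : ℝ) < finrank ℚ K := Nat.cast_pos.mpr finrank_pos
      refine (isLittleO_iff_tendsto' ?_).mpr ?_
      · filter_upwards [eventually_ne_atTop 0] with x hx h using absurd h hx
      · refine (tendsto_rpow_neg_atTop (y := (2 * finrank ℚ K : ℝ)⁻¹) (by positivity)).congr' ?_
        filter_upwards [eventually_gt_atTop 0] with x hx
        rw [sub_eq_add_neg, Real.rpow_add hx, Real.rpow_one, mul_div_cancel_left₀ _ hx.ne']
    have h2 := ((hsum.trans_isLittleO h1).tendsto_div_nhds_zero).add_const (∑ C, c C)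
    rw [zero_add] at h2
    refine h2.congr' ?_
    filter_upwards [eventually_gt_atTop 0] with x hx
    field_simp
    ring
  rw [dedekindZeta_residue_def, tendsto_nhds_unique (tendsto_norm_le_div_atTop₀ K) hlim]
  exact hsum

theorem sum_card_norm_eq_sub_isBigO :
    (fun x : ℝ ↦ ∑ k ∈ Finset.Icc 1 ⌊x⌋₊, (Nat.card {I : Ideal (𝓞 K) // absNorm I = k} : ℝ) -
      dedekindZeta_residue K * x) =O[atTop] fun x ↦ x ^ (1 - (2 * finrank ℚ K : ℝ)⁻¹) := by
  refine (card_norm_le_sub_isBigO K).congr' ?_ EventuallyEq.rfl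
  filter_upwards [eventually_ge_atTop 0] with x hx
  simp_rw [← Nat.le_floor_iff hx, ← Nat.cast_sum]
  congr 2
  set n := ⌊x⌋₊
  -- The added `1` counts the zero ideal, the only one of norm `0`.
  rw [← add_left_inj 1, ← card_norm_le_eq_card_norm_le_add_one,
    show Finset.Icc 1 n = Finset.Ioc 0 n from Finset.Icc_succ_left_eq_Ioc _ _,
    show 1 = Nat.card {I : Ideal (𝓞 K) // absNorm I = 0} by simp [Ideal.absNorm_eq_zero_iff],
    Finset.sum_Ioc_add_eq_sum_Icc (n.zero_le),
    ← Finset.card_preimage_eq_sum_card_image_eq (fun k _ ↦ finite_setOfPred_absNorm_eq k)]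
  simp [Set.coe_eq_subtype]

end NumberField.Ideal

/-! ### The Dedekind zeta function and its Euler product. -/

namespace NumberField

open Filter Topology Module

variable (K : Type*) [Field K] [NumberField K]

/-- The Dedekind zeta function of a number field of degree `n` extends meromorphically to the
half-plane `1 - 1 / (2n) < Re s`, with at most a simple pole at `s = 1`. -/
theorem exists_dedekindZeta_eq_add :
    ∃ g : ℂ → ℂ, DifferentiableOn ℂ g {s | 1 - (2 * finrank ℚ K : ℝ)⁻¹ < s.re} ∧
      ∀ s : ℂ, 1 < s.re →
        LSeriesSummable (fun n ↦ (Nat.card {I : Ideal (𝓞 K) // Ideal.absNorm I = n} : ℂ)) s ∧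
        dedekindZeta K s = dedekindZeta_residue K * s / (s - 1) + g s := by
  obtain ⟨g, hg, h⟩ := LSeries_eq_add_of_sum_sub_isBigO
    (f := fun n ↦ (Nat.card {I : Ideal (𝓞 K) // Ideal.absNorm I = n} : ℝ))
    (fun _ ↦ Nat.cast_nonneg _) (by rw [sub_le_self_iff]; positivity)
    (Ideal.sum_card_norm_eq_sub_isBigO K)
  exact ⟨g, hg, by simpa [dedekindZeta] using h⟩

end NumberField

open Filter Topology in
/-- **Euler product** for a completely multiplicative absolutely summable function on the ideals of
a Dedekind domain. -/
theorem Ideal.hasProd_one_sub_of_summable_norm {R : Type*} [CommRing R] [IsDedekindDomain R]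
    (f : Ideal R →*₀ ℂ) (hf : Summable fun I ↦ ‖f I‖) :
    ∑' I, f I ≠ 0 ∧
      HasProd (fun P : HeightOneSpectrum R ↦ 1 - f P.asIdeal) (∑' I, f I)⁻¹ := by
  classical
  -- A sieve: `Z S` restricts `f` to ideals divisible by no prime of `S`. Adding a prime to `S`
  -- multiplies the sum by its Euler factor, and in the limit only the unit ideal survives.
  let Z : Finset (HeightOneSpectrum R) → Ideal R → ℂ := fun S I ↦
    if ∀ P ∈ S, ¬ P.asIdeal ∣ I then f I else 0
  have hZle (S : Finset (HeightOneSpectrum R)) (I : Ideal R) : ‖Z S I‖ ≤ ‖f I‖ := by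
    simp only [Z]
    split_ifs <;> simp
  have hZs (S : Finset (HeightOneSpectrum R)) : Summable (Z S) :=
    Summable.of_norm_bounded hf (hZle S)
  have hstep (P : HeightOneSpectrum R) (S : Finset (HeightOneSpectrum R)) (hP : P ∉ S) :
      ∑' I, Z (insert P S) I = (1 - f P.asIdeal) * ∑' I, Z S I := by
    have hinj : Function.Injective (fun J : Ideal R ↦ P.asIdeal * J) := fun J J' h ↦
      mul_left_cancel₀ P.ne_bot h
    have hcop (J : Ideal R) : Z S (P.asIdeal * J) = f P.asIdeal * Z S J := by
      have : (∀ Q ∈ S, ¬ Q.asIdeal ∣ P.asIdeal * J) ↔ ∀ Q ∈ S, ¬ Q.asIdeal ∣ J := by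
        refine forall₂_congr fun Q hQ ↦ not_congr ?_
        rw [Q.prime.dvd_mul, or_iff_right]
        intro h
        have : Q = P := HeightOneSpectrum.ext
          ((P.isMaximal.eq_of_le Q.isPrime.ne_top (Ideal.le_of_dvd h)).symm)
        exact hP (this ▸ hQ)
      simp only [Z, this, map_mul]
      split_ifs <;> simp
    set Y : Ideal R → ℂ := fun I ↦ if P.asIdeal ∣ I then Z S I else 0
    have hsplit (I : Ideal R) : Z (insert P S) I = Z S I - Y I := by
      by_cases h : P.asIdeal ∣ I <;> simp [Z, Y, h]
    have hY : Summable Y := by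
      refine Summable.of_norm_bounded hf fun I ↦ ?_
      simp only [Y]
      split_ifs
      · exact hZle S I
      · simp
    have hYs : ∑' I, Y I = f P.asIdeal * ∑' I, Z S I := by
      rw [← hinj.tsum_eq (f := Y), ← tsum_mul_left]
      · refine tsum_congr fun J ↦ ?_
        simp [Y, hcop]
      · intro I hI
        have : P.asIdeal ∣ I := by
          by_contra h
          simp [Y, h] at hI
        obtain ⟨J, rfl⟩ := this
        exact ⟨J, rfl⟩
    simp_rw [hsplit]
    rw [(hZs S).tsum_sub hY, hYs]
    ring
  have hprod (S : Finset (HeightOneSpectrum R)) :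
      (∏ P ∈ S, (1 - f P.asIdeal)) * ∑' I, f I = ∑' I, Z S I := by
    induction S using Finset.induction_on with
    | empty => simp [Z]
    | insert P S hP ih => rw [Finset.prod_insert hP, mul_assoc, ih, hstep P S hP]
  have hlim : Tendsto (fun S ↦ ∑' I, Z S I) atTop (𝓝 1) := by
    have h1 : ∑' I : Ideal R, (if I = 1 then (1 : ℂ) else 0) = 1 := tsum_ite_eq _ _
    rw [← h1]
    refine tendsto_tsum_of_dominated_convergence hf (fun I ↦ ?_)
      (Eventually.of_forall fun S I ↦ hZle S I)
    refine tendsto_const_nhds.congr' ?_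
    by_cases hI1 : I = 1
    · filter_upwards with S
      have : ∀ P ∈ S, ¬ P.asIdeal ∣ (1 : Ideal R) := fun P _ h ↦
        P.prime.not_isUnit (isUnit_of_dvd_one h)
      subst hI1
      simp only [Z, if_pos this, if_pos, map_one]
    by_cases hI0 : I = 0
    · filter_upwards with S
      simp only [Z, hI0, map_zero, ite_self, if_neg (hI0 ▸ hI1)]
    · obtain ⟨M, hM, hIM⟩ := Ideal.exists_le_maximal I (by rwa [← Ideal.one_eq_top])
      let P : HeightOneSpectrum R := ⟨M, hM.isPrime, fun h ↦ hI0 (le_bot_iff.mp (h ▸ hIM))⟩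
      filter_upwards [eventually_ge_atTop {P}] with S hS
      have : ¬ ∀ P ∈ S, ¬ P.asIdeal ∣ I := fun h ↦
        h P (hS (Finset.mem_singleton_self P)) (Ideal.dvd_iff_le.mpr hIM)
      simp only [Z, if_neg hI1, if_neg this]
  have hlim' : Tendsto (fun S : Finset (HeightOneSpectrum R) ↦
      (∏ P ∈ S, (1 - f P.asIdeal)) * ∑' I, f I) atTop (𝓝 1) := by
    simpa only [hprod] using hlim
  have hne : ∑' I, f I ≠ 0 := by
    intro h
    simp only [h, mul_zero] at hlim'
    exact zero_ne_one (tendsto_nhds_unique tendsto_const_nhds hlim')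
  refine ⟨hne, ?_⟩
  have := hlim'.mul_const (∑' I, f I)⁻¹
  simp_rw [mul_inv_cancel_right₀ hne, one_mul] at this
  exact this

namespace NumberField

variable (K : Type*) [Field K] [NumberField K]

/-- The completely multiplicative function `I ↦ N(I)^{-s}` on the ideals of `𝓞 K`. -/
noncomputable def absNormCpow {s : ℂ} (hs : s ≠ 0) : Ideal (𝓞 K) →*₀ ℂ where
  toFun I := (Ideal.absNorm I : ℂ) ^ (-s)
  map_zero' := by simp [hs]
  map_one' := by simp
  map_mul' I J := by
    rw [map_mul, Nat.cast_mul, Complex.natCast_mul_natCast_cpow]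

/-- Group the ideals by norm; the fibres are finite, and the zero ideal contributes `0` because `s ≠
0`. -/
theorem hasSum_absNorm_cpow {s : ℂ} (hs : 1 < s.re) :
    Summable (fun I : Ideal (𝓞 K) ↦ ‖(Ideal.absNorm I : ℂ) ^ (-s)‖) ∧
      HasSum (fun I : Ideal (𝓞 K) ↦ (Ideal.absNorm I : ℂ) ^ (-s)) (dedekindZeta K s) := by
  obtain ⟨g, -, h⟩ := exists_dedekindZeta_eq_add K
  have hsum := (h s hs).1
  have hs0 : s ≠ 0 := fun h ↦ by simp [h] at hs; linarith
  let e := Equiv.sigmaFiberEquiv fun I : Ideal (𝓞 K) ↦ Ideal.absNorm I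
  have hfin (n : ℕ) : Finite {I : Ideal (𝓞 K) // Ideal.absNorm I = n} :=
    Ideal.finite_setOfPred_absNorm_eq n
  have hterm (n : ℕ) : LSeries.term
      (fun n ↦ (Nat.card {I : Ideal (𝓞 K) // Ideal.absNorm I = n} : ℂ)) s n =
        Nat.card {I : Ideal (𝓞 K) // Ideal.absNorm I = n} * (n : ℂ) ^ (-s) := by
    rw [LSeries.term_def]
    split_ifs with hn
    · simp [hn, hs0]
    · rw [Complex.cpow_neg, div_eq_mul_inv]
  have hnorm : Summable (fun I : Ideal (𝓞 K) ↦ ‖(Ideal.absNorm I : ℂ) ^ (-s)‖) := by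
    refine e.summable_iff.mp ((summable_sigma_of_nonneg fun _ ↦ norm_nonneg _).mpr
      ⟨fun n ↦ Summable.of_finite, (summable_norm_iff.mpr hsum).congr fun n ↦ ?_⟩)
    have := Fintype.ofFinite {I : Ideal (𝓞 K) // Ideal.absNorm I = n}
    rw [hterm, tsum_fintype, norm_mul, Complex.norm_natCast,
      Finset.sum_congr rfl (g := fun _ ↦ ‖(n : ℂ) ^ (-s)‖) fun I _ ↦ ?_,
      Finset.sum_const, Finset.card_univ, nsmul_eq_mul, Nat.card_eq_fintype_card]
    simp [e, I.2]
  refine ⟨hnorm, ?_⟩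
  have hfib (n : ℕ) : HasSum
      (fun I : {I : Ideal (𝓞 K) // Ideal.absNorm I = n} ↦ (Ideal.absNorm I.1 : ℂ) ^ (-s))
      (Nat.card {I : Ideal (𝓞 K) // Ideal.absNorm I = n} * (n : ℂ) ^ (-s)) := by
    have := Fintype.ofFinite {I : Ideal (𝓞 K) // Ideal.absNorm I = n}
    rw [Nat.card_eq_fintype_card, ← nsmul_eq_mul, ← Finset.card_univ, ← Finset.sum_const]
    rw [← Finset.sum_congr rfl fun I (_ : I ∈ Finset.univ) ↦
      congrArg (fun m : ℕ ↦ (m : ℂ) ^ (-s)) I.2]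
    exact hasSum_fintype _
  have h1 := (e.hasSum_iff.mpr hnorm.of_norm.hasSum).sigma hfib
  have h2 : HasSum (LSeries.term _ s) (dedekindZeta K s) := hsum.hasSum
  rw [funext hterm] at h2
  rw [h2.unique h1]
  exact hnorm.of_norm.hasSum

/-- The **Euler product** of the Dedekind zeta function. -/
theorem dedekindZeta_ne_zero_and_hasProd {s : ℂ} (hs : 1 < s.re) :
    dedekindZeta K s ≠ 0 ∧ HasProd (fun P : HeightOneSpectrum (𝓞 K) ↦
      1 - (Ideal.absNorm P.asIdeal : ℂ) ^ (-s)) (dedekindZeta K s)⁻¹ := by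
  have hs0 : s ≠ 0 := fun h ↦ by simp [h] at hs; linarith
  obtain ⟨h1, h2⟩ := hasSum_absNorm_cpow K hs
  have := Ideal.hasProd_one_sub_of_summable_norm (absNormCpow K hs0) h1
  rwa [show ∑' I, absNormCpow K hs0 I = dedekindZeta K s from h2.tsum_eq] at this

theorem summable_norm_absNorm_cpow_heightOneSpectrum {s : ℂ} (hs : 1 < s.re) :
    Summable fun P : HeightOneSpectrum (𝓞 K) ↦ ‖(Ideal.absNorm P.asIdeal : ℂ) ^ (-s)‖ :=
  (hasSum_absNorm_cpow K hs).1.comp_injective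
    (i := fun P : HeightOneSpectrum (𝓞 K) ↦ P.asIdeal) fun _ _ h ↦ HeightOneSpectrum.ext h

end NumberField

/-! ### Primes above split and non-split primes. -/

namespace NumberField

variable (K L : Type*) [Field K] [NumberField K] [Field L] [NumberField L] [Algebra K L]

/-- The primes of `𝓞 L` whose pullback is `p` are the primes lying over `p`. -/
def fiberUnderEquivPrimesOver (p : HeightOneSpectrum (𝓞 K)) :
    {P : HeightOneSpectrum (𝓞 L) // P.under (𝓞 K) = p} ≃ p.asIdeal.primesOver (𝓞 L) where
  toFun P := ⟨P.1.asIdeal, P.1.isPrime, ⟨congrArg HeightOneSpectrum.asIdeal P.2.symm⟩⟩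
  invFun Q := ⟨⟨Q.1, Q.2.1, Ideal.ne_bot_of_mem_primesOver p.ne_bot Q.2⟩,
    HeightOneSpectrum.ext Q.2.2.over.symm⟩
  left_inv _ := rfl
  right_inv _ := rfl

instance finite_fiber_under (p : HeightOneSpectrum (𝓞 K)) :
    Finite {P : HeightOneSpectrum (𝓞 L) // P.under (𝓞 K) = p} :=
  have := p.isPrime.isMaximal p.ne_bot
  Finite.of_equiv _ (fiberUnderEquivPrimesOver K L p).symm

theorem sum_ramificationIdx_mul_inertiaDeg (p : HeightOneSpectrum (𝓞 K))
    [Fintype (p.asIdeal.primesOver (𝓞 L))] :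
    ∑ Q : p.asIdeal.primesOver (𝓞 L), Q.1.ramificationIdx (𝓞 K) * Q.1.inertiaDeg (𝓞 K) =
      Module.finrank K L := by
  rw [Ideal.sum_ramification_inertia_eq_finrank]
  exact (IsFractionRing.finrank_eq (𝓞 K) K (𝓞 L) L).symm

theorem natCard_fiber_under_le (p : HeightOneSpectrum (𝓞 K)) :
    Nat.card {P : HeightOneSpectrum (𝓞 L) // P.under (𝓞 K) = p} ≤ Module.finrank K L := by
  have := p.isPrime.isMaximal p.ne_bot
  rw [Nat.card_congr (fiberUnderEquivPrimesOver K L p), Nat.card_eq_fintype_card,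
    ← sum_ramificationIdx_mul_inertiaDeg K L p, ← Finset.card_univ, Finset.card_eq_sum_ones]
  refine Finset.sum_le_sum fun Q _ ↦ ?_
  have := Q.2.1
  exact Nat.mul_pos (Ideal.ramificationIdx_pos _ _) (Ideal.inertiaDeg_pos _ _)

theorem natCard_fiber_under_of_mem_splitPrimes {p : HeightOneSpectrum (𝓞 K)}
    (hp : p ∈ PolarDensity.splitPrimes K L) :
    Nat.card {P : HeightOneSpectrum (𝓞 L) // P.under (𝓞 K) = p} = Module.finrank K L := by
  have := p.isPrime.isMaximal p.ne_bot
  rw [Nat.card_congr (fiberUnderEquivPrimesOver K L p), Nat.card_eq_fintype_card,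
    ← sum_ramificationIdx_mul_inertiaDeg K L p, ← Finset.card_univ, Finset.card_eq_sum_ones]
  refine Finset.sum_congr rfl fun Q _ ↦ ?_
  obtain ⟨h1, h2⟩ := hp Q.1 Q.2.1 Q.2.2
  rw [h1, h2]

variable {K L}

instance (P : HeightOneSpectrum (𝓞 L)) : P.asIdeal.LiesOver (P.under (𝓞 K)).asIdeal := ⟨rfl⟩

theorem absNorm_under_pow_inertiaDeg (P : HeightOneSpectrum (𝓞 L)) :
    Ideal.absNorm (P.under (𝓞 K)).asIdeal ^ P.asIdeal.inertiaDeg (𝓞 K) =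
      Ideal.absNorm P.asIdeal :=
  have := P.isPrime
  Ideal.absNorm_pow_inertiaDeg _ _

theorem absNorm_eq_of_under_mem_splitPrimes {P : HeightOneSpectrum (𝓞 L)}
    (hP : P.under (𝓞 K) ∈ PolarDensity.splitPrimes K L) :
    Ideal.absNorm P.asIdeal = Ideal.absNorm (P.under (𝓞 K)).asIdeal := by
  rw [← absNorm_under_pow_inertiaDeg (K := K), (hP P.asIdeal P.isPrime inferInstance).2, pow_one]

/-- This is where normality enters: all primes above `p` share the same `e` and `f`, so a single one
with `e = f = 1` forces complete splitting. -/
theorem ramificationIdx_ne_one_or_two_le_inertiaDeg [IsGalois K L] {P : HeightOneSpectrum (𝓞 L)}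
    (hP : P.under (𝓞 K) ∉ PolarDensity.splitPrimes K L) :
    P.asIdeal.ramificationIdx (𝓞 K) ≠ 1 ∨ 2 ≤ P.asIdeal.inertiaDeg (𝓞 K) := by
  have hPp := P.isPrime
  have : IsGaloisGroup Gal(L/K) (𝓞 K) (𝓞 L) := .of_isFractionRing _ _ _ K L
  by_contra! h
  have hf : P.asIdeal.inertiaDeg (𝓞 K) = 1 :=
    le_antisymm (Nat.lt_succ_iff.mp h.2) (Ideal.inertiaDeg_pos _ _)
  refine hP fun Q hQ hQp ↦ ⟨?_, ?_⟩
  · rw [Ideal.ramificationIdx_eq_of_isGaloisGroup (P.under (𝓞 K)).asIdeal Q P.asIdeal Gal(L/K),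
      h.1]
  · rw [Ideal.inertiaDeg_eq_of_isGaloisGroup (P.under (𝓞 K)).asIdeal Q P.asIdeal Gal(L/K), hf]

-- Ramified primes divide the different, a nonzero ideal.
variable (K L) in
theorem finite_ramificationIdx_ne_one :
    {P : HeightOneSpectrum (𝓞 L) | P.asIdeal.ramificationIdx (𝓞 K) ≠ 1}.Finite := by
  refine (Ideal.finite_factors (I := differentIdeal (𝓞 K) (𝓞 L)) differentIdeal_ne_bot).subset
    fun P hP ↦ ?_
  have := P.isPrime
  exact dvd_differentIdeal_iff.mpr fun _ ↦ hP (Ideal.ramificationIdx_eq_one _ _)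

-- Each prime of `K` is counted at most `[L:K]` times.
variable (K L) in
theorem summable_absNorm_under_rpow {σ : ℝ} (hσ : 1 < σ) :
    Summable fun P : HeightOneSpectrum (𝓞 L) ↦
      (Ideal.absNorm (P.under (𝓞 K)).asIdeal : ℝ) ^ (-σ) := by
  have hnn (p : HeightOneSpectrum (𝓞 K)) : 0 ≤ (Ideal.absNorm p.asIdeal : ℝ) ^ (-σ) := by
    positivity
  have hK : Summable fun p : HeightOneSpectrum (𝓞 K) ↦ (Ideal.absNorm p.asIdeal : ℝ) ^ (-σ) := by
    refine (summable_norm_absNorm_cpow_heightOneSpectrum K (s := σ) (by simpa)).congr fun p ↦ ?_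
    rw [Complex.norm_natCast_cpow_of_pos (zero_lt_one.trans (HeightOneSpectrum.one_lt_absNorm p))]
    simp
  refine (Equiv.sigmaFiberEquiv fun P : HeightOneSpectrum (𝓞 L) ↦ P.under (𝓞 K)).summable_iff.mp
    ((summable_sigma_of_nonneg fun x ↦ hnn _).mpr ⟨fun p ↦ Summable.of_finite, ?_⟩)
  refine .of_nonneg_of_le (fun p ↦ tsum_nonneg fun x ↦ hnn _) (fun p ↦ ?_)
    (hK.mul_left (Module.finrank K L : ℝ))
  have := Fintype.ofFinite {P : HeightOneSpectrum (𝓞 L) // P.under (𝓞 K) = p}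
  rw [tsum_fintype, Finset.sum_congr rfl
    (g := fun _ ↦ (Ideal.absNorm p.asIdeal : ℝ) ^ (-σ)) fun P _ ↦ ?_,
    Finset.sum_const, Finset.card_univ, nsmul_eq_mul, ← Nat.card_eq_fintype_card]
  · gcongr
    exact natCard_fiber_under_le K L p
  · exact congrArg (fun q : HeightOneSpectrum (𝓞 K) ↦ (Ideal.absNorm q.asIdeal : ℝ) ^ (-σ)) P.2

variable (K L) in
/-- For a Galois extension, the primes of `L` not lying over completely split primes have a
convergent Dirichlet series to the right of `1 / 2`. -/
theorem summable_absNorm_rpow_of_under_notMem_splitPrimes [IsGalois K L] {σ : ℝ}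
    (hσ : 1 / 2 < σ) :
    Summable fun P : {P : HeightOneSpectrum (𝓞 L) | P.under (𝓞 K) ∈
      PolarDensity.splitPrimes K L}ᶜ.Elem ↦ (Ideal.absNorm P.1.asIdeal : ℝ) ^ (-σ) := by
  -- Outside the finitely many ramified primes `N(P) = N(p)^f` with `f ≥ 2`, so `N(P)^(-σ) ≤
  -- N(p)^(-2σ)`, and `2σ > 1`.
  refine Summable.of_norm_bounded_eventually
    ((summable_absNorm_under_rpow K L (σ := 2 * σ) (by linarith)).subtype _) ?_
  refine ((finite_ramificationIdx_ne_one K L).preimage Subtype.val_injective.injOn).subset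
    fun P hP ↦ ?_
  by_contra he
  refine hP ?_
  have hf := (ramificationIdx_ne_one_or_two_le_inertiaDeg P.2).resolve_left he
  have h1 : (1 : ℝ) ≤ Ideal.absNorm (P.1.under (𝓞 K)).asIdeal := by
    exact_mod_cast (HeightOneSpectrum.one_lt_absNorm (P.1.under (𝓞 K))).le
  change ‖(Ideal.absNorm P.1.asIdeal : ℝ) ^ (-σ)‖ ≤
    (Ideal.absNorm (P.1.under (𝓞 K)).asIdeal : ℝ) ^ (-(2 * σ))
  rw [Real.norm_of_nonneg (by positivity), ← absNorm_under_pow_inertiaDeg (K := K), Nat.cast_pow,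
    ← Real.rpow_natCast, ← Real.rpow_mul (by positivity)]
  refine Real.rpow_le_rpow_of_exponent_le h1 ?_
  have : (2 : ℝ) ≤ P.1.asIdeal.inertiaDeg (𝓞 K) := by exact_mod_cast hf
  nlinarith

end NumberField

theorem HasProd.pow_of_natCard_fiber_eq {α β M : Type*} [CommMonoid M] [TopologicalSpace M]
    [ContinuousMul M] [RegularSpace M] {h : α → β} {A : Set β} {f : β → M} {a : M} {n : ℕ}
    (ha : HasProd (fun x : {x // h x ∈ A} ↦ f (h x)) a)
    [∀ y, Finite {x // h x = y}] (hn : ∀ y ∈ A, Nat.card {x // h x = y} = n) :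
    HasProd (fun y : A ↦ f y ^ n) a := by
  let e := Equiv.sigmaSubtypeFiberEquivSubtype (p := fun x ↦ h x ∈ A) (q := (· ∈ A)) h
    fun _ ↦ Iff.rfl
  have he : HasProd (fun x : Σ y : {y // y ∈ A}, {x // h x = y} ↦ f (h x.2)) a :=
    e.hasProd_iff.mpr ha
  refine he.sigma fun y ↦ ?_
  have := Fintype.ofFinite {x // h x = y.1}
  rw [← hn y y.2, Nat.card_eq_fintype_card, ← Finset.card_univ, ← Finset.prod_const,
    ← Finset.prod_congr rfl fun x (_ : x ∈ Finset.univ) ↦ congrArg f x.2]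
  exact hasProd_fintype _

/-! ### Partial zeta functions and the pole at `1`. -/

namespace NumberField

section EulerFactors

variable {K : Type*} [Field K] [NumberField K]

theorem norm_absNorm_cpow (P : HeightOneSpectrum (𝓞 K)) (s : ℂ) :
    ‖(Ideal.absNorm P.asIdeal : ℂ) ^ (-s)‖ = (Ideal.absNorm P.asIdeal : ℝ) ^ (-s.re) := by
  rw [Complex.norm_natCast_cpow_of_pos (zero_lt_one.trans (HeightOneSpectrum.one_lt_absNorm P)),
    Complex.neg_re]

theorem one_add_neg_absNorm_cpow_ne_zero (P : HeightOneSpectrum (𝓞 K)) {s : ℂ} (hs : 0 < s.re) :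
    1 + -(Ideal.absNorm P.asIdeal : ℂ) ^ (-s) ≠ 0 := by
  intro h
  have h1 := norm_absNorm_cpow P s
  rw [add_neg_eq_zero.mp h |>.symm, norm_one] at h1
  have h2 : (1 : ℝ) < Ideal.absNorm P.asIdeal := by
    exact_mod_cast HeightOneSpectrum.one_lt_absNorm P
  exact (Real.rpow_lt_one_of_one_lt_of_neg h2 (neg_neg_of_pos hs)).ne h1.symm

theorem multipliable_one_sub_absNorm_cpow (A : Set (HeightOneSpectrum (𝓞 K))) {s : ℂ}
    (hs : 1 < s.re) : Multipliable fun p : A ↦ 1 - (Ideal.absNorm p.1.asIdeal : ℂ) ^ (-s) := by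
  simp_rw [sub_eq_add_neg]
  refine multipliable_one_add_of_summable ?_
  simp_rw [norm_neg]
  exact (summable_norm_absNorm_cpow_heightOneSpectrum K hs).comp_injective Subtype.val_injective

/-- The factors `1 - N(p)^(-s)` are summable perturbations of `1`, so their product converges to a
nonzero limit and can be inverted factor by factor. -/
theorem hasProd_inv_partialZeta (A : Set (HeightOneSpectrum (𝓞 K))) {s : ℂ} (hs : 1 < s.re) :
    HasProd (fun p : A ↦ 1 - (Ideal.absNorm p.1.asIdeal : ℂ) ^ (-s))
      (PolarDensity.partialZeta A s)⁻¹ := by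
  have hsum : Summable fun p : A ↦ ‖-(Ideal.absNorm p.1.asIdeal : ℂ) ^ (-s)‖ := by
    simp_rw [norm_neg]
    exact (summable_norm_absNorm_cpow_heightOneSpectrum K hs).comp_injective Subtype.val_injective
  have h := (multipliable_one_add_of_summable hsum).hasProd
  have hne := tprod_one_add_ne_zero_of_summable
    (fun p : A ↦ one_add_neg_absNorm_cpow_ne_zero p.1 (zero_lt_one.trans hs)) hsum
  simp only [← sub_eq_add_neg] at h hne
  have hinv := h.inv₀ hne
  rwa [PolarDensity.partialZeta, hinv.tprod_eq, inv_inv]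

/-- A product of Euler factors over a set of primes is holomorphic and nonzero wherever the
underlying Dirichlet series converges absolutely. -/
theorem differentiableOn_tprod_one_sub_absNorm_cpow {B : Set (HeightOneSpectrum (𝓞 K))} {σ : ℝ}
    (hσ : 0 ≤ σ) (hB : Summable fun P : B ↦ (Ideal.absNorm P.1.asIdeal : ℝ) ^ (-σ)) :
    DifferentiableOn ℂ (fun s : ℂ ↦ ∏' P : B, (1 - (Ideal.absNorm P.1.asIdeal : ℂ) ^ (-s)))
        {s | σ < s.re} ∧
      ∀ s : ℂ, σ < s.re → ∏' P : B, (1 - (Ideal.absNorm P.1.asIdeal : ℂ) ^ (-s)) ≠ 0 := by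
  have hopen : IsOpen {s : ℂ | σ < s.re} := isOpen_lt continuous_const Complex.continuous_re
  have hle (P : B) (s : ℂ) (hs : σ < s.re) :
      ‖-(Ideal.absNorm P.1.asIdeal : ℂ) ^ (-s)‖ ≤ (Ideal.absNorm P.1.asIdeal : ℝ) ^ (-σ) := by
    rw [norm_neg, norm_absNorm_cpow]
    refine Real.rpow_le_rpow_of_exponent_le ?_ (neg_le_neg hs.le)
    exact_mod_cast (HeightOneSpectrum.one_lt_absNorm P.1).le
  have hdiff (P : B) : Differentiable ℂ fun s : ℂ ↦ (Ideal.absNorm P.1.asIdeal : ℂ) ^ (-s) := by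
    have : (Ideal.absNorm P.1.asIdeal : ℂ) ≠ 0 := by
      exact_mod_cast (zero_lt_one.trans (HeightOneSpectrum.one_lt_absNorm P.1)).ne'
    exact fun s ↦ (differentiableAt_id.neg).const_cpow (Or.inl this)
  constructor
  · have h := hB.hasProdLocallyUniformlyOn_one_add hopen
      (f := fun (P : B) (s : ℂ) ↦ -(Ideal.absNorm P.1.asIdeal : ℂ) ^ (-s))
      (.of_forall fun P s hs ↦ hle P s hs) fun P ↦ (hdiff P).neg.continuous.continuousOn
    simp only [← sub_eq_add_neg] at h
    refine h.differentiableOn (.of_forall fun S ↦ ?_) hopen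
    simpa [Finset.prod_fn] using
      DifferentiableOn.finsetProd fun P _ ↦ ((hdiff P).const_sub 1).differentiableOn
  · intro s hs
    have := tprod_one_add_ne_zero_of_summable
      (fun P : B ↦ one_add_neg_absNorm_cpow_ne_zero P.1 (hσ.trans_lt hs))
      (.of_nonneg_of_le (fun _ ↦ norm_nonneg _) (fun P ↦ hle P s hs) hB)
    simpa only [← sub_eq_add_neg] using this

end EulerFactors

variable (K L : Type*) [Field K] [NumberField K] [Field L] [NumberField L] [Algebra K L]

/-- Split the Euler product of `ζ_L` according to whether the prime below splits completely; over a
split prime the `n` factors coincide. This identity does not need normality. -/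
theorem partialZeta_splitPrimes_pow {s : ℂ} (hs : 1 < s.re) :
    PolarDensity.partialZeta (PolarDensity.splitPrimes K L) s ^ Module.finrank K L =
      dedekindZeta L s * ∏' P : {P : HeightOneSpectrum (𝓞 L) | P.under (𝓞 K) ∈
        PolarDensity.splitPrimes K L}ᶜ.Elem, (1 - (Ideal.absNorm P.1.asIdeal : ℂ) ^ (-s)) := by
  set A := PolarDensity.splitPrimes K L
  set n := Module.finrank K L
  obtain ⟨hζ, hprod⟩ := dedekindZeta_ne_zero_and_hasProd L hs
  set G : Set (HeightOneSpectrum (𝓞 L)) := {P | P.under (𝓞 K) ∈ A}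
  have hG := (multipliable_one_sub_absNorm_cpow G hs).hasProd
  have hsplit := (hG.mul_compl (f := fun P : HeightOneSpectrum (𝓞 L) ↦
    1 - (Ideal.absNorm P.asIdeal : ℂ) ^ (-s))
      (multipliable_one_sub_absNorm_cpow Gᶜ hs).hasProd).unique hprod
  have hA : HasProd (fun p : A ↦ (1 - (Ideal.absNorm p.1.asIdeal : ℂ) ^ (-s)) ^ n)
      (∏' P : G, (1 - (Ideal.absNorm P.1.asIdeal : ℂ) ^ (-s))) := by
    refine HasProd.pow_of_natCard_fiber_eq
      (h := fun P : HeightOneSpectrum (𝓞 L) ↦ P.under (𝓞 K))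
      (f := fun p ↦ 1 - (Ideal.absNorm p.asIdeal : ℂ) ^ (-s)) ?_
      fun p hp ↦ natCard_fiber_under_of_mem_splitPrimes K L hp
    have hfun : (fun P : {P : HeightOneSpectrum (𝓞 L) // P.under (𝓞 K) ∈ A} ↦
        1 - (Ideal.absNorm (P.1.under (𝓞 K)).asIdeal : ℂ) ^ (-s)) =
        fun P ↦ 1 - (Ideal.absNorm P.1.asIdeal : ℂ) ^ (-s) :=
      funext fun P ↦ by rw [absNorm_eq_of_under_mem_splitPrimes (K := K) P.2]
    rw [hfun]
    exact hG
  rw [hA.unique ((hasProd_inv_partialZeta A hs).pow n)] at hsplit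
  have hZ : PolarDensity.partialZeta A s ≠ 0 := by
    intro h
    rw [h, inv_zero, zero_pow Module.finrank_pos.ne', zero_mul] at hsplit
    exact hζ (inv_eq_zero.mp hsplit.symm)
  rw [inv_pow, inv_mul_eq_iff_eq_mul₀ (pow_ne_zero _ hZ), eq_mul_inv_iff_mul_eq₀ hζ] at hsplit
  rw [← hsplit, mul_comm]

/-- The power of the partial zeta function of the completely split primes has a simple pole. -/
theorem extendsWithPoleAtOne_partialZeta_splitPrimes_pow [IsGalois K L] :
    PolarDensity.ExtendsWithPoleAtOne (fun s ↦
      PolarDensity.partialZeta (PolarDensity.splitPrimes K L) s ^ Module.finrank K L) 1 := by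
  obtain ⟨g, hg, hζ⟩ := exists_dedekindZeta_eq_add L
  -- Any `σ` strictly between `1/2` and `1` would do.
  obtain ⟨hH, hH0⟩ := differentiableOn_tprod_one_sub_absNorm_cpow (by norm_num)
    (summable_absNorm_rpow_of_under_notMem_splitPrimes K L (σ := 3 / 4) (by norm_num))
  have hmul := fun s ↦ partialZeta_splitPrimes_pow K L (s := s)
  set H : ℂ → ℂ := fun s ↦ ∏' P : {P : HeightOneSpectrum (𝓞 L) | P.under (𝓞 K) ∈
    PolarDensity.splitPrimes K L}ᶜ.Elem, (1 - (Ideal.absNorm P.1.asIdeal : ℂ) ^ (-s))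
  set ρ : ℂ := (dedekindZeta_residue L : ℂ)
  have hρ : ρ ≠ 0 := Complex.ofReal_ne_zero.mpr (dedekindZeta_residue_ne_zero L)
  set U : Set ℂ := {s | 1 - (2 * Module.finrank ℚ L : ℝ)⁻¹ < s.re} ∩ {s | 3 / 4 < s.re}
  have hU : IsOpen U := (isOpen_lt continuous_const Complex.continuous_re).inter
    (isOpen_lt continuous_const Complex.continuous_re)
  have h1U : (1 : ℂ) ∈ U := by
    have : (0 : ℝ) < Module.finrank ℚ L := by exact_mod_cast Module.finrank_pos
    refine ⟨?_, ?_⟩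
    · simp only [Set.mem_ofPred_eq, Complex.one_re]
      have : (0 : ℝ) < (2 * Module.finrank ℚ L : ℝ)⁻¹ := by positivity
      linarith
    · norm_num
  have hgA : AnalyticOnNhd ℂ g U := (hg.mono Set.inter_subset_left).analyticOnNhd hU
  have hHA : AnalyticOnNhd ℂ H U := (hH.mono Set.inter_subset_right).analyticOnNhd hU
  have hid : AnalyticOnNhd ℂ (fun s : ℂ ↦ s - 1) U := fun _ _ ↦ by fun_prop
  have hF : MeromorphicOn (fun s ↦ (ρ * s / (s - 1) + g s) * H s) U := fun s hs ↦
    (((MeromorphicAt.const ρ s).mul (MeromorphicAt.id s)).div (hid s hs).meromorphicAt |>.add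
      (hgA s hs).meromorphicAt).mul (hHA s hs).meromorphicAt
  refine ⟨U, hU, h1U, _, hF, fun s _ hs ↦ ?_, ?_⟩
  · change _ = PolarDensity.partialZeta _ s ^ _
    rw [hmul s hs, (hζ s hs).2]
  · refine (meromorphicOrderAt_eq_int_iff (hF 1 h1U)).mpr
      -- This is the extension times `s - 1`; its value at `1` is `ρ * H 1 ≠ 0`.
      ⟨fun s ↦ (ρ * s + (s - 1) * g s) * H s, ?_, ?_, ?_⟩
    · exact (((analyticAt_const.mul analyticAt_id).add ((hid 1 h1U).mul (hgA 1 h1U))).mul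
        (hHA 1 h1U))
    · simpa [hρ] using hH0 1 (by norm_num)
    · filter_upwards [self_mem_nhdsWithin] with s hs
      have : s - 1 ≠ 0 := sub_ne_zero.mpr hs
      simp only [Nat.cast_one, zpow_neg_one, smul_eq_mul]
      field_simp

end NumberField

theorem theorem3 (K L : Type*) [Field K] [NumberField K] [Field L] [NumberField L]
    [Algebra K L] [Normal K L] :
    PolarDensity.HasPolarDensity (PolarDensity.splitPrimes K L)
        (1 / (Module.finrank K L : ℚ)) ∧
      PolarDensity.ExtendsWithPoleAtOne
        (fun s ↦ PolarDensity.partialZeta (PolarDensity.splitPrimes K L) s ^ Module.finrank K L)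
        1 := by
  -- Separability is automatic in characteristic zero.
  have : IsGalois K L := ⟨⟩
  have h := extendsWithPoleAtOne_partialZeta_splitPrimes_pow K L
  exact ⟨⟨Module.finrank K L, 1, Module.finrank_pos, h, by simp⟩, h⟩
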